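/- **Setting.** A *triangulation* of a subset $X$ of a Euclidean space is a geometric simplicial complex $\Sigma$ with underlying space $X$ that is locally finite in $X$ (finite, if $X$ is compact). A map $f\colon X\to Y$ between subsets of Euclidean spaces is *PL* if there is a triangulation of $X$ on each simplex of which $f$ is affine; a *PL homeomorphism* is a homeomorphism that is PL. A subset $M\subset\mathbb{R}^N$ is a *PL $n$-manifold* (with or without boundary) if every point of $M$ has a neighbourhood in $M$ that is PL homeomorphic to the cube $[0,1]^n$. For $p\in M$ and a triangulation $\Sigma$ of $M$, let $R_\Sigma$ be the set of rays with root $p$ in the star of $p$, that is, of the half-open segments $[p,x)$ with $x$ in the link of $p$ (the union of the faces not containing $p$ of the simplices containing $p$). The *tangent sphere* $R_p$ is the direct limit of the sets $R_\Sigma$ over the triangulations $\Sigma$ of $M$, along restriction of rays; thus two rays are identified if they agree near $p$. A PL homeomorphism $f$ of $M$ with $f(p)=p$ acts on $R_p$ by sending the class of a ray $r$ to the class of the ray that agrees with $f(r)$ near $p$. **Theorem.** Let $M\subset\mathbb{R}^N$ be a connected PL manifold (with or without boundary), let $G$ be a finitely generated group acting on $M$ by PL homeomorphisms, and let $p\in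 M$ be a global fixed point of $G$. Suppose that (i) $G$ acts trivially on the tangent sphere $R_p$; (ii) $H_1(G;\mathbb{R})=0$. Then $G$ acts trivially on $M$, i.e. $gx=x$ for all $g\in G$ and $x\in M$. -/

import Mathlib

open Set Filter Topology

namespace PLStability

section Polyhedra

set_option linter.unusedSectionVars false

variable {E F : Type*} [NormedAddCommGroup E] [NormedSpace ℝ E]
  [NormedAddCommGroup F] [NormedSpace ℝ F]

/-- A triangulation of a subset `X` of a Euclidean space: a geometric simplicial complex whose
underlying space is `X` and which is locally finite in `X`. If `X` is compact, this means
that the complex has finitely many simplices. -/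
structure Triangulation (X : Set E) where
  complex : Geometry.SimplicialComplex ℝ E
  space_eq : complex.space = X
  locallyFinite : ∀ x ∈ X, ∃ U ∈ 𝓝 x,
    {s ∈ complex.faces | (convexHull ℝ (s : Set E) ∩ U).Nonempty}.Finite

/-- `f : X → Y` is piecewise linear: it is affine on each simplex of some triangulation of `X`. -/
def IsPL {X : Set E} {Y : Set F} (f : X → Y) : Prop :=
  ∃ T : Triangulation X, ∀ s ∈ T.complex.faces, ∃ A : E →ᵃ[ℝ] F,
    ∀ x : X, (x : E) ∈ convexHull ℝ (s : Set E) → (f x : F) = A x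

/-- The standard cube `[0,1]ⁿ`. -/
def cube (n : ℕ) : Set (EuclideanSpace ℝ (Fin n)) :=
  {y | ∀ i, y i ∈ Icc (0 : ℝ) 1}

/-- `M` is a PL `n`-manifold, with or without boundary: every point of `M` has a neighbourhood
in `M` that is PL homeomorphic to the cube `[0,1]ⁿ`. The point may correspond to a boundary point of
the cube; this happens exactly at the boundary points of `M`. -/
def IsPLManifold (n : ℕ) (M : Set E) : Prop :=
  ∀ x ∈ M, ∃ N ⊆ M, N ∈ 𝓝[M] x ∧ ∃ φ : N ≃ₜ cube n, IsPL φ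

/-- The link of a point `p` in a triangulation: the union of the faces that do not contain `p`, of
the simplices that contain `p`. If `p` is a vertex, then a simplex contains `p` iff `p` is one of
its vertices, and this is the usual link of a vertex. -/
def Triangulation.link {X : Set E} (T : Triangulation X) (p : E) : Set E :=
  {x | ∃ s ∈ T.complex.faces, ∃ t ∈ T.complex.faces, t ⊆ s ∧
    p ∈ convexHull ℝ (s : Set E) ∧ p ∉ convexHull ℝ (t : Set E) ∧ x ∈ convexHull ℝ (t : Set E)}

/-- The half-open segment `[p, x)`. -/
def ray (p x : E) : Set E := AffineMap.lineMap p x '' Ico (0 : ℝ) 1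

/-- The tangent sphere `R_Σ` of a triangulation `Σ` at `p`: the set of all rays with root `p` in the
star of `p`, that is, of the segments `[p, x)` with `x` in the link of `p`. -/
def Triangulation.rays {X : Set E} (T : Triangulation X) (p : E) : Set (Set E) :=
  {r | ∃ x ∈ T.link p, r = ray p x}

/-- Rays of two triangulations are identified when they agree near `p`, i.e. when they restrict to
the same ray of a common subdivision. -/
instance raySetoid (M : Set E) (p : E) : Setoid (Σ T : Triangulation M, T.rays p) where
  r a b := (a.2 : Set E) =ᶠ[𝓝 p] (b.2 : Set E)
  iseqv := ⟨fun _ => EventuallyEq.rfl, fun h => h.symm, fun h h' => h.trans h'⟩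

/-- The tangent sphere `R_p` of `M` at `p`: the direct limit of the sets `R_Σ` over the
triangulations `Σ` of `M`, along the restriction maps. -/
def TangentSphere (M : Set E) (p : E) : Type _ := Quotient (raySetoid M p)

/-- The class in `R_p` of a ray `r` of the triangulation `T`. -/
def TangentSphere.mk {M : Set E} {p : E} (T : Triangulation M) (r : T.rays p) :
    TangentSphere M p := Quotient.mk (raySetoid M p) ⟨T, r⟩

lemma ray_germ {p x y : E} {c : ℝ} (hc : 0 < c) (hy : y ≠ p)
    (hx : x = AffineMap.lineMap p y c) : ray p x =ᶠ[𝓝 p] ray p y := by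
  have hpos : 0 < ‖y - p‖ := norm_pos_iff.2 (sub_ne_zero.2 hy)
  have hm : 0 < min 1 c * ‖y - p‖ := mul_pos (lt_min one_pos hc) hpos
  rw [eventuallyEq_set]
  filter_upwards [Metric.ball_mem_nhds p hm] with z hz
  rw [mem_ball_iff_norm] at hz
  subst hx
  have key : ∀ t : ℝ, 0 ≤ t → z = p + t • (y - p) → t < 1 ∧ t < c := by
    intro t ht h
    have : t * ‖y - p‖ < min 1 c * ‖y - p‖ := by
      rw [h, add_sub_cancel_left, norm_smul, Real.norm_of_nonneg ht] at hz
      exact hz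
    exact lt_min_iff.1 (lt_of_mul_lt_mul_right this hpos.le)
  constructor
  · rintro ⟨t, ht, h⟩
    have h' : z = p + (t * c) • (y - p) := by
      rw [← h]; simp [AffineMap.lineMap_apply, mul_smul, add_comm]
    refine ⟨t * c, ⟨mul_nonneg ht.1 hc.le, (key _ (mul_nonneg ht.1 hc.le) h').1⟩, ?_⟩
    rw [h']; simp [AffineMap.lineMap_apply, add_comm]
  · rintro ⟨t, ht, h⟩
    have h' : z = p + t • (y - p) := by
      rw [← h]; simp [AffineMap.lineMap_apply, add_comm]
    refine ⟨t / c, ⟨div_nonneg ht.1 hc.le, (div_lt_one hc).2 (key t ht.1 h').2⟩, ?_⟩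
    rw [h']
    simp [AffineMap.lineMap_apply, ← mul_smul, hc.ne', add_comm]

/-- A segment inside one simplex, starting at `p`, extends or shrinks to a segment ending in the
link of `p`. -/
lemma Triangulation.exists_link {X : Set E} (T : Triangulation X) {p y : E} (hy : y ≠ p)
    {s : Finset E} (hs : s ∈ T.complex.faces) (hps : p ∈ convexHull ℝ (s : Set E))
    (hys : y ∈ convexHull ℝ (s : Set E)) :
    ∃ c : ℝ, 0 < c ∧ AffineMap.lineMap p y c ∈ T.link p := by
  classical
  obtain ⟨u, hu0, hu1, hu⟩ := Finset.mem_convexHull'.1 hps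
  obtain ⟨w, hw0, hw1, hw⟩ := Finset.mem_convexHull'.1 hys
  have hne : (s.filter fun i => w i < u i).Nonempty := by
    by_contra h
    rw [Finset.not_nonempty_iff_eq_empty, Finset.filter_eq_empty_iff] at h
    have h' : ∀ i ∈ s, u i = w i :=
      (Finset.sum_eq_sum_iff_of_le fun i hi => not_lt.1 (h hi)).1 (hu1.trans hw1.symm)
    apply hy
    rw [← hu, ← hw]
    exact Finset.sum_congr rfl fun i hi => by rw [h' i hi]
  obtain ⟨i, hi, hmin⟩ := Finset.exists_min_image _ (fun i => u i / (u i - w i)) hne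
  obtain ⟨his, hiw⟩ := Finset.mem_filter.1 hi
  have hui : 0 < u i := (hw0 i his).trans_lt hiw
  set c := u i / (u i - w i) with hc
  have hcpos : 0 < c := div_pos hui (sub_pos.2 hiw)
  set v : E → ℝ := fun j => u j + c * (w j - u j) with hv
  have hvi : v i = 0 := by
    have : u i - w i ≠ 0 := (sub_pos.2 hiw).ne'
    simp only [hv, hc]; field_simp; ring
  have hv0 : ∀ j ∈ s, 0 ≤ v j := by
    intro j hj
    rcases lt_or_ge (w j) (u j) with h | h
    · have := hmin j (Finset.mem_filter.2 ⟨hj, h⟩)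
      rw [le_div_iff₀ (sub_pos.2 h)] at this
      simp only [hv]; linarith
    · have := mul_nonneg hcpos.le (sub_nonneg.2 h)
      simp only [hv]; linarith [hu0 j hj]
  have hv1 : ∑ j ∈ s, v j = 1 := by
    simp only [hv, Finset.sum_add_distrib, ← Finset.mul_sum, Finset.sum_sub_distrib, hu1, hw1]
    ring
  have hvx : ∑ j ∈ s, v j • j = AffineMap.lineMap p y c := by
    simp only [hv, add_smul, mul_smul, sub_smul, Finset.sum_add_distrib, ← Finset.smul_sum,
      Finset.sum_sub_distrib, hu, hw]
    simp [AffineMap.lineMap_apply, add_comm]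
  have hers : ∀ a : E → ℝ, a i = 0 → ∑ j ∈ s.erase i, a j = ∑ j ∈ s, a j := fun a ha =>
    Finset.sum_erase _ ha
  have hv1' : ∑ j ∈ s.erase i, v j = 1 := (hers v hvi).trans hv1
  have hxt : AffineMap.lineMap p y c ∈ convexHull ℝ ((s.erase i : Finset E) : Set E) :=
    Finset.mem_convexHull'.2 ⟨v, fun j hj => hv0 j (Finset.mem_of_mem_erase hj), hv1', by
      rw [← hvx]; exact Finset.sum_erase _ (by simp [hvi])⟩
  have hpt : p ∉ convexHull ℝ ((s.erase i : Finset E) : Set E) := by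
    intro h
    obtain ⟨a, -, ha1, ha⟩ := Finset.mem_convexHull'.1 h
    have h1 : ∑ j ∈ s, (if j = i then 0 else a j) = 1 := by
      rw [← ha1, ← Finset.sum_erase s (a := i) (by simp)]
      exact Finset.sum_congr rfl fun j hj => if_neg (Finset.ne_of_mem_erase hj)
    have h2 : ∑ j ∈ s, (if j = i then 0 else a j) • j = p := by
      rw [← ha, ← Finset.sum_erase s (a := i) (by simp)]
      exact Finset.sum_congr rfl fun j hj => by rw [if_neg (Finset.ne_of_mem_erase hj)]
    have := (T.complex.indep hs).eq_of_sum_eq_sum_subtype (w₁ := u)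
      (w₂ := fun j => if j = i then 0 else a j) (hu1.trans h1.symm) (hu.trans h2.symm) i his
    simp only [if_true] at this
    exact hui.ne' this
  have hte : (s.erase i).Nonempty := by
    by_contra h
    rw [Finset.not_nonempty_iff_eq_empty] at h
    simp [h] at hv1'
  exact ⟨c, hcpos, s, hs, s.erase i,
    T.complex.down_closed hs (Finset.erase_subset _ _) hte, Finset.erase_subset _ _, hps, hpt, hxt⟩

/-- A short initial piece of a segment in `X` lies in one simplex. -/
lemma Triangulation.exists_simplex {X : Set E} (T : Triangulation X) {p y : E}
    (hyX : segment ℝ p y ⊆ X) :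
    ∃ s ∈ T.complex.faces, ∃ d : ℝ, 0 < d ∧ d ≤ 1 ∧ p ∈ convexHull ℝ (s : Set E) ∧
      AffineMap.lineMap p y d ∈ convexHull ℝ (s : Set E) := by
  obtain ⟨U, hU, hfin⟩ := T.locallyFinite p (hyX (left_mem_segment ℝ p y))
  have hlim : Tendsto (fun k : ℕ => AffineMap.lineMap p y (1 / ((k : ℝ) + 1))) atTop (𝓝 p) := by
    have h := (AffineMap.lineMap_continuous (R := ℝ) (p := p) (q := y)).tendsto 0
    rw [AffineMap.lineMap_apply_zero] at h
    exact h.comp tendsto_one_div_add_atTop_nhds_zero_nat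
  have hmem : ∀ k : ℕ, ∃ s ∈ T.complex.faces,
      AffineMap.lineMap p y (1 / ((k : ℝ) + 1)) ∈ convexHull ℝ (s : Set E) := by
    intro k
    rw [← Geometry.SimplicialComplex.mem_space_iff, T.space_eq]
    apply hyX
    rw [segment_eq_image_lineMap]
    refine ⟨_, ⟨by positivity, ?_⟩, rfl⟩
    rw [div_le_one (by positivity)]
    linarith [(Nat.cast_nonneg k : (0 : ℝ) ≤ k)]
  choose S hS hSm using hmem
  have hev : ∀ᶠ k in atTop, S k ∈ {s ∈ T.complex.faces |
      (convexHull ℝ (s : Set E) ∩ U).Nonempty} :=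
    (hlim.eventually hU).mono fun k hk => ⟨hS k, _, hSm k, hk⟩
  obtain ⟨s, hs, hfreq⟩ : ∃ s ∈ T.complex.faces, ∃ᶠ k in atTop, S k = s := by
    by_contra! h
    have : ∀ᶠ k in atTop, ∀ s ∈ {s ∈ T.complex.faces |
        (convexHull ℝ (s : Set E) ∩ U).Nonempty}, S k ≠ s :=
      (hfin.eventually_all).2 fun s hs => h s hs.1
    obtain ⟨k, h1, h2⟩ := (hev.and this).exists
    exact h2 _ h1 rfl
  have hcl : IsClosed (convexHull ℝ (s : Set E)) := s.finite_toSet.isClosed_convexHull ℝ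
  have hps : p ∈ convexHull ℝ (s : Set E) :=
    hcl.mem_of_frequently_of_tendsto (hfreq.mono fun k hk => hk ▸ hSm k) hlim
  obtain ⟨k, hk⟩ := hfreq.exists
  refine ⟨s, hs, 1 / ((k : ℝ) + 1), by positivity, ?_, hps, hk ▸ hSm k⟩
  rw [div_le_one (by positivity)]
  linarith [(Nat.cast_nonneg k : (0 : ℝ) ≤ k)]

/-- Every segment in `X` starting at `p` has the germ of a ray of the triangulation. -/
lemma Triangulation.exists_ray {X : Set E} (T : Triangulation X) {p y : E} (hy : y ≠ p)
    (hyX : segment ℝ p y ⊆ X) : ∃ r ∈ T.rays p, r =ᶠ[𝓝 p] ray p y := by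
  obtain ⟨s, hs, d, hd, -, hps, hds⟩ := T.exists_simplex hyX
  have hne : AffineMap.lineMap p y d ≠ p := by
    rw [Ne, AffineMap.lineMap_eq_left_iff]
    exact fun h => h.elim (fun h => hy h.symm) hd.ne'
  obtain ⟨c, hc, hl⟩ := T.exists_link hne hs hps hds
  exact ⟨_, ⟨_, hl, rfl⟩, (ray_germ hc hne rfl).trans (ray_germ hd hy rfl)⟩

/-- The image of `A ∩ M` under a self-map of `M`, as a subset of the ambient space. -/
def imageSet {M : Set E} (f : M → M) (A : Set E) : Set E :=
  {y | ∃ x : M, (x : E) ∈ A ∧ (f x : E) = y}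

lemma imageSet_germ {M : Set E} (f : M ≃ₜ M) {p : M} (hp : f p = p) {A B : Set E}
    (h : A =ᶠ[𝓝 (p : E)] B) : imageSet f A =ᶠ[𝓝 (p : E)] imageSet f B := by
  rw [eventuallyEq_set] at h ⊢
  have hc : Tendsto (fun y : M => (f.symm y : E)) (𝓝 p) (𝓝 (p : E)) := by
    have h1 := (continuous_subtype_val.comp f.symm.continuous).tendsto p
    rwa [Function.comp_apply, f.symm_apply_eq.2 hp.symm] at h1
  have h2 := hc.eventually h
  rw [nhds_subtype_eq_comap, eventually_comap] at h2
  filter_upwards [h2] with y hy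
  constructor
  · rintro ⟨x, hx, rfl⟩
    refine ⟨x, ?_, rfl⟩
    have := hy (f x) rfl
    rw [f.symm_apply_apply] at this
    exact this.1 hx
  · rintro ⟨x, hx, rfl⟩
    refine ⟨x, ?_, rfl⟩
    have := hy (f x) rfl
    rw [f.symm_apply_apply] at this
    exact this.2 hx

lemma imageSet_affine {M : Set E} (f : M → M) (A : E →ᵃ[ℝ] E) {p y : E}
    (hM : segment ℝ p y ⊆ M)
    (h : ∀ x : M, (x : E) ∈ segment ℝ p y → (f x : E) = A x) :
    imageSet f (ray p y) = ray (A p) (A y) := by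
  have hsub : ray p y ⊆ segment ℝ p y := by
    rw [segment_eq_image_lineMap]
    exact image_mono Ico_subset_Icc_self
  ext z
  constructor
  · rintro ⟨x, hx, rfl⟩
    rw [h x (hsub hx)]
    obtain ⟨t, ht, hxt⟩ := hx
    exact ⟨t, ht, by rw [← hxt, AffineMap.apply_lineMap]⟩
  · rintro ⟨t, ht, rfl⟩
    have hr : AffineMap.lineMap p y t ∈ ray p y := ⟨t, ht, rfl⟩
    refine ⟨⟨_, hM (hsub hr)⟩, hr, ?_⟩
    rw [h _ (hsub hr), AffineMap.apply_lineMap]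

lemma Triangulation.link_spec {X : Set E} (T : Triangulation X) {p x : E} (hx : x ∈ T.link p) :
    x ≠ p ∧ segment ℝ p x ⊆ X := by
  obtain ⟨s, hs, t, ht, hts, hps, hpt, hxt⟩ := hx
  refine ⟨fun h => hpt (h ▸ hxt), ?_⟩
  rw [← T.space_eq]
  exact ((convex_convexHull ℝ _).segment_subset hps
    (convexHull_mono (by exact_mod_cast hts) hxt)).trans
      (Geometry.SimplicialComplex.convexHull_subset_space hs)

/-- A PL homeomorphism fixing `p` maps germs of rays at `p` to germs of rays at `p`. -/
lemma exists_image_ray {M : Set E} (f : M ≃ₜ M) (hf : IsPL f) {p : M} (hp : f p = p)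
    (a : Σ T : Triangulation M, T.rays (p : E)) :
    ∃ b : (Σ T : Triangulation M, T.rays (p : E)),
      (b.2 : Set E) =ᶠ[𝓝 (p : E)] imageSet f (a.2 : Set E) := by
  obtain ⟨T, r, x, hx, rfl⟩ := a
  obtain ⟨hxp, hxM⟩ := T.link_spec hx
  obtain ⟨T', hT'⟩ := hf
  obtain ⟨s, hs, d, hd, hd1, hps, hds⟩ := T'.exists_simplex hxM
  obtain ⟨A, hA⟩ := hT' s hs
  set y := AffineMap.lineMap (p : E) x d with hydef
  have hne : y ≠ p := by
    rw [Ne, hydef, AffineMap.lineMap_eq_left_iff]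
    exact fun h => h.elim (fun h => hxp h.symm) hd.ne'
  have hseg : segment ℝ (p : E) y ⊆ convexHull ℝ (s : Set E) :=
    (convex_convexHull ℝ _).segment_subset hps hds
  have hsM : segment ℝ (p : E) y ⊆ M := by
    refine hseg.trans ?_
    rw [← T'.space_eq]
    exact Geometry.SimplicialComplex.convexHull_subset_space hs
  have hAp : A p = p := by rw [← hA p hps, hp]
  have himg := imageSet_affine f A hsM fun z hz => hA z (hseg hz)
  rw [hAp] at himg
  have hyM : y ∈ M := hsM (right_mem_segment ℝ _ _)
  have hAy : A y = f ⟨y, hyM⟩ := (hA ⟨y, hyM⟩ hds).symm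
  have hne' : A y ≠ p := by
    intro h
    rw [hAy] at h
    have h1 : f ⟨y, hyM⟩ = f p := by rw [hp]; exact Subtype.ext h
    exact hne (congrArg Subtype.val (f.injective h1))
  have hsub : segment ℝ (p : E) (A y) ⊆ M := by
    have h1 : segment ℝ (p : E) (A y) = A '' segment ℝ (p : E) y := by
      rw [image_segment, hAp]
    rw [h1]
    rintro _ ⟨z, hz, rfl⟩
    rw [← hA ⟨z, hsM hz⟩ (hseg hz)]
    exact Subtype.coe_prop _
  obtain ⟨r', hr', hgerm⟩ := T'.exists_ray hne' hsub
  refine ⟨⟨T', r', hr'⟩, hgerm.trans ?_⟩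
  rw [← himg]
  exact imageSet_germ f hp (ray_germ hd hxp hydef)

/-- The map of `R_p` induced by a PL homeomorphism `f` fixing `p`: it sends the class of a ray `r`
to the class of the ray that agrees with `f(r)` near `p`. -/
noncomputable def tangentMap {M : Set E} (f : M ≃ₜ M) (hf : IsPL f) {p : M} (hp : f p = p) :
    TangentSphere M (p : E) → TangentSphere M (p : E) :=
  Quotient.map (fun a => Classical.choose (exists_image_ray f hf hp a)) fun a b hab =>
    (Classical.choose_spec (exists_image_ray f hf hp a)).trans
      ((imageSet_germ f hp hab).trans
        (Classical.choose_spec (exists_image_ray f hf hp b)).symm)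

lemma tangentMap_mk {M : Set E} (f : M ≃ₜ M) (hf : IsPL f) {p : M} (hp : f p = p)
    (T T' : Triangulation M) (r : T.rays (p : E)) (r' : T'.rays (p : E)) :
    tangentMap f hf hp (.mk T r) = .mk T' r' ↔
      (r' : Set E) =ᶠ[𝓝 (p : E)] imageSet f (r : Set E) := by
  have hs := Classical.choose_spec (exists_image_ray f hf hp ⟨T, r⟩)
  refine Quotient.eq.trans ⟨fun h => ?_, fun h => hs.trans h.symm⟩
  exact EventuallyEq.trans (EventuallyEq.symm h) hs

lemma tangentMap_one {G : Type*} [Group G] {M : Set E} (ρ : G →* (M ≃ₜ M))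
    (hρ : ∀ g, IsPL (ρ g)) {p : M} (hp : ∀ g, ρ g p = p)
    (a : TangentSphere M (p : E)) : tangentMap (ρ 1) (hρ 1) (hp 1) a = a := by
  induction a using Quotient.inductionOn with | _ a
  obtain ⟨T, r⟩ := a
  refine (tangentMap_mk _ (hρ 1) (hp 1) T T r r).2 ?_
  obtain ⟨r, x, hx, rfl⟩ := r
  have hM : ray (p : E) x ⊆ M := by
    refine Subset.trans ?_ (T.link_spec hx).2
    rw [segment_eq_image_lineMap]
    exact image_mono Ico_subset_Icc_self
  refine EventuallyEq.of_eq (Set.ext fun z => ⟨fun hz => ⟨⟨z, hM hz⟩, hz, ?_⟩, ?_⟩)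
  · simp
  · rintro ⟨z, hz, rfl⟩
    simpa using hz

lemma tangentMap_mul {G : Type*} [Group G] {M : Set E} (ρ : G →* (M ≃ₜ M))
    (hρ : ∀ g, IsPL (ρ g)) {p : M} (hp : ∀ g, ρ g p = p)
    (g h : G) (a : TangentSphere M (p : E)) :
    tangentMap (ρ (g * h)) (hρ (g * h)) (hp (g * h)) a =
      tangentMap (ρ g) (hρ g) (hp g) (tangentMap (ρ h) (hρ h) (hp h) a) := by
  induction a using Quotient.inductionOn with | _ a
  obtain ⟨T, r⟩ := a
  obtain ⟨⟨T₁, r₁⟩, h₁⟩ := exists_image_ray (ρ h) (hρ h) (hp h) ⟨T, r⟩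
  obtain ⟨⟨T₂, r₂⟩, h₂⟩ := exists_image_ray (ρ g) (hρ g) (hp g) ⟨T₁, r₁⟩
  have e₁ := (tangentMap_mk _ (hρ h) (hp h) T T₁ r r₁).2 h₁
  have e₂ := (tangentMap_mk _ (hρ g) (hp g) T₁ T₂ r₁ r₂).2 h₂
  have e₃ := (tangentMap_mk _ (hρ (g * h)) (hp (g * h)) T T₂ r r₂).2 <| by
    refine (h₂.trans (imageSet_germ _ (hp g) h₁)).trans (EventuallyEq.of_eq ?_)
    ext z
    constructor
    · rintro ⟨x, ⟨w, hw, hwx⟩, rfl⟩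
      refine ⟨w, hw, ?_⟩
      rw [map_mul, Homeomorph.mul_apply, Subtype.ext hwx]
    · rintro ⟨w, hw, rfl⟩
      exact ⟨ρ h w, ⟨w, hw, rfl⟩, by rw [map_mul, Homeomorph.mul_apply]⟩
  change tangentMap _ (hρ (g * h)) (hp (g * h)) (.mk T r) =
    tangentMap _ (hρ g) (hp g) (tangentMap _ (hρ h) (hp h) (.mk T r))
  rw [e₃, e₁, e₂]

/-- The action of `G` on the tangent sphere `R_p` induced by an action of `G` on `M` by PL
homeomorphisms that fix `p`. -/
noncomputable def tangentAction {G : Type*} [Group G] {M : Set E} (ρ : G →* (M ≃ₜ M))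
    (hρ : ∀ g, IsPL (ρ g)) {p : M} (hp : ∀ g, ρ g p = p) :
    G →* Equiv.Perm (TangentSphere M (p : E)) := MonoidHom.toHomPerm
  { toFun := fun g => (tangentMap (ρ g) (hρ g) (hp g) : Function.End _)
    map_one' := funext fun a => tangentMap_one ρ hρ hp a
    map_mul' := fun g h => funext fun a => tangentMap_mul ρ hρ hp g h a }

end Polyhedra

end PLStability

/-! This is a piecewise linear form of Thurston stability. Since H₁(G; ℝ) is Gᵃᵇ ⊗ ℝ, its vanishing
kills every homomorphism from G to ℝ, hence, through the logarithm, every homomorphism to the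
positive reals. The proof keeps producing such characters.

At `p`, a PL map preserving the germ of a ray rescales it by a positive factor. This factor is
multiplicative in g, hence 1, so each element of G is the identity near `p`
(`eventually_fixed_base`).

Let the good set consist of the points near which a fixed finite generating set acts trivially. It
is open and contains `p`; as `M` is connected, it remains to see that it is closed. In a chart at a
limit point the generators are affine off finitely many hyperplanes. A generic segment starting at a
good point meets these hyperplanes one at a time (`fixed_of_fixed_near`). When it reaches a wall ℓ =
0, the germs are the identity behind the wall and of the form x ↦ x + ℓ(x) w_g beyond it. The
numbers 1 + ℓ(w_g), with the linear part of ℓ, are positive and multiplicative, hence 1; then g ↦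
w_g is additive, hence 0 (`germ_action_trivial`). So triviality crosses the wall. The argument runs
in the open cube and reaches the boundary by density (`eventually_fixed_of_frequently`). -/

namespace PLStability

/-! ### Vanishing of real characters. -/

section Characters

open TensorProduct

/-- If `H₁(G; ℝ) = 0`, then every additive character `G → ℝ` vanishes. -/
theorem character_eq_zero {G : Type} [Group G]
    (hH : CategoryTheory.Limits.IsZero (groupHomology (Rep.trivial ℝ G ℝ) 1))
    (f : G → ℝ) (hf : ∀ g k, f (g * k) = f g + f k) (g : G) : f g = 0 := by
  let F : G →* Multiplicative ℝ := MonoidHom.mk' (fun g => Multiplicative.ofAdd (f g)) fun g k => by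
    rw [hf]; rfl
  let A : Additive (Abelianization G) →+ ℝ := (Abelianization.lift F).toAdditiveLeft
  -- `B` recovers `f g` from the tensor `of g ⊗ 1`, which vanishes because `e` identifies Gᵃᵇ ⊗ ℝ
  -- with the trivial group H₁.
  let B : (Additive (Abelianization G)) ⊗[ℤ] ℝ →ₗ[ℤ] ℝ :=
    TensorProduct.lift ((LinearMap.mul ℤ ℝ).comp A.toIntLinearMap)
  have hz : Subsingleton (groupHomology (Rep.trivial ℝ G ℝ) 1) :=
    ModuleCat.subsingleton_of_isZero hH
  let e := groupHomology.H1AddEquivOfIsTrivial (Rep.trivial ℝ G ℝ)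
  have h0 : (Additive.ofMul (Abelianization.of g) ⊗ₜ[ℤ] (1 : ℝ)) = 0 := by
    apply e.symm.injective
    exact Subsingleton.elim (α := groupHomology (Rep.trivial ℝ G ℝ) 1) _ _
  have h1 : B (Additive.ofMul (Abelianization.of g) ⊗ₜ[ℤ] (1 : ℝ)) = f g * 1 := rfl
  rw [h0, map_zero, mul_one] at h1
  exact h1.symm

/-- A group without nonzero additive real characters has no nontrivial positive multiplicative
ones. -/
theorem mul_character_eq_one {G : Type*} [Group G]
    (hG : ∀ f : G → ℝ, (∀ g k, f (g * k) = f g + f k) → ∀ g, f g = 0)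
    (f : G → ℝ) (hpos : ∀ g, 0 < f g) (hf : ∀ g k, f (g * k) = f g * f k) (g : G) : f g = 1 := by
  have := hG (fun g => Real.log (f g))
    (fun g k => by rw [hf, Real.log_mul (hpos g).ne' (hpos k).ne']) g
  exact Real.eq_one_of_pos_of_log_eq_zero (hpos g) this

end Characters

/-! ### Germs of actions at a wall. -/

section Germs

variable {V : Type*} [NormedAddCommGroup V] [NormedSpace ℝ V]

lemma tendsto_add_smul (p v : V) : Tendsto (fun t : ℝ => p + t • v) (𝓝[>] 0) (𝓝 p) := by
  have : Continuous (fun t : ℝ => p + t • v) := by fun_prop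
  simpa using (this.tendsto 0).mono_left (nhdsWithin_le_nhds (s := Ioi 0))

/-- A nonzero affine functional with a zero is not constant. Moving by t • v raises ℓ by exactly t,
so the half-line c + t • v with t > 0 probes the positive side of the wall. -/
lemma exists_affine_direction {ℓ : V →ᵃ[ℝ] ℝ} {c : V} (hc : ℓ c = 0) (hℓ : ℓ ≠ 0) :
    ∃ v : V, ℓ.linear v = 1 := by
  have h : ∃ x, ℓ x ≠ 0 := by
    by_contra! h
    exact hℓ (AffineMap.ext h)
  obtain ⟨x, hx⟩ := h
  have h1 : ℓ.linear (x - c) = ℓ x := by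
    rw [← vsub_eq_sub, AffineMap.linearMap_vsub, hc, vsub_eq_sub, sub_zero]
  exact ⟨(ℓ x)⁻¹ • (x - c), by rw [map_smul, h1, smul_eq_mul, inv_mul_cancel₀ hx]⟩

lemma affine_apply_add {W : Type*} [AddCommGroup W] [Module ℝ W] (A : V →ᵃ[ℝ] W) (c u : V) :
    A (c + u) = A c + A.linear u := by
  rw [add_comm c u, ← vadd_eq_add u c, AffineMap.map_vadd, vadd_eq_add, add_comm]

/-- An affine map fixing the points of the hyperplane `ℓ = 0` near `c` is a transvection or
dilatation along that hyperplane. -/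
lemma affine_fixing_hyperplane {ℓ : V →ᵃ[ℝ] ℝ} {c : V} (hc : ℓ c = 0) (hℓ : ℓ ≠ 0)
    (L : V →ᵃ[ℝ] V) (hL : ∀ᶠ x in 𝓝 c, ℓ x = 0 → L x = x) :
    ∃ w : V, ∀ x, L x = x + ℓ x • w := by
  obtain ⟨v, hv⟩ := exists_affine_direction hc hℓ
  have hLc : L c = c := hL.self_of_nhds hc
  -- The hypothesis is local, so u is first shrunk to t • u, and t is cancelled afterwards.
  have hker : ∀ u, ℓ.linear u = 0 → L.linear u = u := by
    intro u hu
    obtain ⟨t, h1, h2⟩ := (((tendsto_add_smul c u).eventually hL).and self_mem_nhdsWithin).exists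
    have := h1 (by rw [affine_apply_add, hc, map_smul, hu]; simp)
    rw [affine_apply_add, hLc, map_smul] at this
    exact smul_right_injective V (ne_of_gt h2) (add_left_cancel this)
  -- The vector x - c is ℓ x • v plus a vector of the kernel of ℓ.linear, so only the displacement
  -- of v matters.
  refine ⟨L.linear v - v, fun x => ?_⟩
  have hx : ℓ x = ℓ.linear (x - c) := by
    conv_lhs => rw [← add_sub_cancel c x, affine_apply_add, hc, zero_add]
  have hk := hker (x - c - ℓ x • v) (by rw [map_sub, map_smul, hv, ← hx]; simp)
  have : L x = c + L.linear (x - c) := by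
    conv_lhs => rw [← add_sub_cancel c x, affine_apply_add, hLc]
  rw [map_sub, map_smul, sub_eq_iff_eq_add] at hk
  rw [this, hk, smul_sub]
  abel

/-- A group without real characters, acting by germs at `c` that are the identity on the half-space
`ℓ ≤ 0` and, for a generating set, affine on the half-space `0 ≤ ℓ`, acts trivially near `c`. -/
theorem germ_action_trivial {G : Type*} [Group G]
    (hG : ∀ f : G → ℝ, (∀ g k, f (g * k) = f g + f k) → ∀ g, f g = 0)
    (h : G → V → V) {c : V} (ht : ∀ g, Tendsto (h g) (𝓝 c) (𝓝 c))
    (h1 : ∀ᶠ x in 𝓝 c, h 1 x = x) (hm : ∀ g k, ∀ᶠ x in 𝓝 c, h (g * k) x = h g (h k x))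
    {ℓ : V →ᵃ[ℝ] ℝ} (hc : ℓ c = 0) (hℓ : ℓ ≠ 0) {S : Set G} (hS : Submonoid.closure S = ⊤)
    (hneg : ∀ s ∈ S, ∀ᶠ x in 𝓝 c, ℓ x ≤ 0 → h s x = x)
    (hpos : ∀ s ∈ S, ∃ L : V →ᵃ[ℝ] V, ∀ᶠ x in 𝓝 c, 0 ≤ ℓ x → h s x = L x) (g : G) :
    ∀ᶠ x in 𝓝 c, h g x = x := by
  have hneg' : ∀ g, ∀ᶠ x in 𝓝 c, ℓ x ≤ 0 → h g x = x := by
    intro g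
    induction g using Submonoid.dense_induction S hS with
    | mem s hs => exact hneg s hs
    | one => exact h1.mono fun x hx _ => hx
    | mul g k hg hk =>
      filter_upwards [hm g k, hg, hk] with x e1 e2 e3 hx
      rw [e1, e3 hx, e2 hx]
  -- If g sent x strictly behind the wall, then g⁻¹ would fix the image there; hence x would equal
  -- its image and lie behind the wall too.
  have hside : ∀ g, ∀ᶠ x in 𝓝 c, 0 ≤ ℓ x → 0 ≤ ℓ (h g x) := by
    intro g
    filter_upwards [hm g⁻¹ g, h1, (ht g).eventually (hneg' g⁻¹)] with x e1 e2 e3 hx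
    by_contra! hlt
    have := e3 hlt.le
    rw [← e1, inv_mul_cancel, e2] at this
    rw [← this] at hlt
    exact absurd hx (not_le.2 hlt)
  have hform : ∀ g, ∃ w : V, ∀ᶠ x in 𝓝 c, 0 ≤ ℓ x → h g x = x + ℓ x • w := by
    intro g
    induction g using Submonoid.dense_induction S hS with
    | mem s hs =>
      obtain ⟨L, hL⟩ := hpos s hs
      obtain ⟨w, hw⟩ := affine_fixing_hyperplane hc hℓ L (by
        filter_upwards [hL, hneg s hs] with x e1 e2 hx
        rw [← e1 hx.ge, e2 hx.le])
      exact ⟨w, hL.mono fun x hx h0 => by rw [hx h0, hw]⟩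
    | one => exact ⟨0, h1.mono fun x hx _ => by rw [hx, smul_zero, add_zero]⟩
    | mul g k hg hk =>
      obtain ⟨w, hw⟩ := hg
      obtain ⟨w', hw'⟩ := hk
      -- The factor appears because ℓ (x + ℓ x • w') = (1 + ℓ.linear w') * ℓ x.
      refine ⟨w' + (1 + ℓ.linear w') • w, ?_⟩
      filter_upwards [hm g k, (ht k).eventually hw, hw', hside k] with x e1 e2 e3 e4 hx
      rw [e1, e2 (e4 hx), e3 hx, affine_apply_add, map_smul, smul_eq_mul]
      module
  choose w hw using hform
  obtain ⟨v, hv⟩ := exists_affine_direction hc hℓ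
  have hline := tendsto_add_smul c v
  have hℓv : ∀ t : ℝ, ℓ (c + t • v) = t := fun t => by
    rw [affine_apply_add, hc, map_smul, hv]; simp
  -- The vectors `w g` were chosen separately; their cocycle rule follows by comparing both sides at
  -- one point c + t • v and cancelling t.
  have hmul : ∀ g k, w (g * k) = w k + (1 + ℓ.linear (w k)) • w g := by
    intro g k
    obtain ⟨t, ⟨e1, e2, e3, e4, e5⟩, ht0⟩ := ((hline.eventually ((hm g k).and ((hw (g * k)).and
      (((ht k).eventually (hw g)).and ((hw k).and (hside k)))))).and self_mem_nhdsWithin).exists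
    have h0 : 0 ≤ ℓ (c + t • v) := by rw [hℓv]; exact le_of_lt ht0
    rw [e3 (e5 h0), e4 h0, affine_apply_add ℓ (c + t • v), map_smul, smul_eq_mul, e2 h0, hℓv,
      add_assoc (c + t • v)] at e1
    have e6 := add_left_cancel e1
    apply smul_right_injective V (ne_of_gt ht0)
    simp only
    rw [e6]
    module
  have hmulchar : ∀ g k, 1 + ℓ.linear (w (g * k)) =
      (1 + ℓ.linear (w g)) * (1 + ℓ.linear (w k)) := by
    intro g k
    rw [hmul, map_add, map_smul, smul_eq_mul]; ring
  have hw1 : w 1 = 0 := by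
    obtain ⟨t, ⟨e1, e2⟩, ht0⟩ :=
      ((hline.eventually (h1.and (hw 1))).and self_mem_nhdsWithin).exists
    have e3 := e2 (by rw [hℓv]; exact le_of_lt ht0)
    rw [e1, hℓv, left_eq_add] at e3
    exact (smul_eq_zero.1 e3).resolve_left (ne_of_gt ht0)
  have hnonneg : ∀ g, 0 ≤ 1 + ℓ.linear (w g) := by
    intro g
    obtain ⟨t, ⟨e1, e2⟩, ht0⟩ :=
      ((hline.eventually ((hw g).and (hside g))).and self_mem_nhdsWithin).exists
    have h0 : 0 ≤ ℓ (c + t • v) := by rw [hℓv]; exact le_of_lt ht0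
    have := e2 h0
    rw [e1 h0, affine_apply_add, map_smul, smul_eq_mul, hℓv] at this
    refine nonneg_of_mul_nonneg_right (a := t) ?_ ht0
    linarith
  have hchar : ∀ g, 1 + ℓ.linear (w g) = 1 := by
    refine mul_character_eq_one hG _ (fun g => (hnonneg g).lt_of_ne' fun h0 => ?_) hmulchar
    have := hmulchar g g⁻¹
    rw [mul_inv_cancel, hw1, h0] at this
    simp at this
  -- With the dilatation factors equal to 1, the cocycle is additive, and every continuous
  -- functional turns it into a real character.
  have hw0 : w g = 0 := by
    refine SeparatingDual.eq_zero_of_forall_dual_eq_zero (R := ℝ) fun f => ?_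
    exact hG (fun g => f (w g)) (fun a b => by
      rw [hmul, hchar, one_smul, map_add, add_comm]) g
  filter_upwards [hneg' g, hw g] with x e1 e2
  rcases le_total (ℓ x) 0 with hx | hx
  · exact e1 hx
  · rw [e2 hx, hw0, smul_zero, add_zero]

end Germs

/-! ### Polyhedra and piecewise affine maps. -/

section PiecewiseAffine

set_option linter.unusedSectionVars false

variable {E F H : Type*} [NormedAddCommGroup E] [NormedSpace ℝ E]
  [NormedAddCommGroup F] [NormedSpace ℝ F] [NormedAddCommGroup H] [NormedSpace ℝ H]

/-- A convex polyhedron: a finite intersection of closed half-spaces. -/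
def IsPolyhedron (P : Set E) : Prop :=
  ∃ Λ : Set (E →ᵃ[ℝ] ℝ), Λ.Finite ∧ P = {x | ∀ ℓ ∈ Λ, ℓ x ≤ 0}

lemma IsPolyhedron.inter {P Q : Set E} (hP : IsPolyhedron P) (hQ : IsPolyhedron Q) :
    IsPolyhedron (P ∩ Q) := by
  obtain ⟨Λ, hΛ, rfl⟩ := hP
  obtain ⟨Λ', hΛ', rfl⟩ := hQ
  refine ⟨Λ ∪ Λ', hΛ.union hΛ', ?_⟩
  ext x
  simp only [mem_inter_iff, mem_ofPred_eq, mem_union, or_imp, forall_and]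

lemma IsPolyhedron.preimage {P : Set F} (hP : IsPolyhedron P) (A : E →ᵃ[ℝ] F) :
    IsPolyhedron (A ⁻¹' P) := by
  obtain ⟨Λ, hΛ, rfl⟩ := hP
  refine ⟨(fun ℓ => ℓ.comp A) '' Λ, hΛ.image _, ?_⟩
  ext x
  simp

lemma affine_map_sum {ι : Type*} (A : E →ᵃ[ℝ] F) (s : Finset ι) (w : ι → ℝ) (v : ι → E)
    (hw : ∑ i ∈ s, w i = 1) : A (∑ i ∈ s, w i • v i) = ∑ i ∈ s, w i • A (v i) := by
  have h := s.map_affineCombination v w hw A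
  rwa [Finset.affineCombination_eq_linear_combination _ _ _ hw,
    Finset.affineCombination_eq_linear_combination _ _ _ hw] at h

/-- An affinely independent finite set extends to an affine basis; in the associated coordinates its
convex hull is cut out by linear inequalities. -/
lemma exists_simplex_coords [FiniteDimensional ℝ E] {s : Finset E}
    (hs : AffineIndependent ℝ ((↑) : s → E)) :
    IsPolyhedron (convexHull ℝ (s : Set E)) ∧ ∃ κ : E → E →ᵃ[ℝ] ℝ,
      ∀ i ∈ s, κ i i = 1 ∧ ∀ j ∈ s, i ≠ j → κ i j = 0 := by
  classical
  obtain ⟨t, hst, hti, htop⟩ := exists_subset_affineIndependent_affineSpan_eq_top hs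
  let b : AffineBasis t ℝ E := ⟨(↑), hti, by rw [Subtype.range_coe]; exact htop⟩
  have hfin : Finite t := finite_of_fin_dim_affineIndependent ℝ hti
  have : Fintype t := Fintype.ofFinite t
  have hbc : ∀ i, b i = (i : E) := fun i => rfl
  let κ : E → E →ᵃ[ℝ] ℝ := fun i => if h : i ∈ t then b.coord ⟨i, h⟩ else 0
  have hκ : ∀ (i : E) (h : i ∈ t), κ i = b.coord ⟨i, h⟩ := fun i h => dif_pos h
  have hκδ : ∀ i ∈ t, ∀ j ∈ t, κ i j = if i = j then 1 else 0 := by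
    intro i hi j hj
    rw [hκ i hi]
    exact (b.coord_apply ⟨i, hi⟩ ⟨j, hj⟩).trans (by simp)
  have hcomb : ∀ w : E → ℝ, ∑ i ∈ s, w i = 1 → ∀ j ∈ t,
      κ j (∑ i ∈ s, w i • i) = if j ∈ s then w j else 0 := by
    intro w hw j hj
    rw [affine_map_sum _ _ _ _ hw]
    rw [Finset.sum_congr rfl fun i hi => by rw [hκδ j hj i (hst hi)]]
    simp
  have hsum : ∀ x, ∑ i ∈ t.toFinset, κ i x = 1 ∧ ∑ i ∈ t.toFinset, κ i x • i = x := by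
    intro x
    have h1 := b.sum_coord_apply_eq_one x
    have h2 := b.linear_combination_coord_eq_self x
    have hc : ∀ i : t, b.coord i = κ i := fun i => (hκ i i.2).symm
    simp only [hc, hbc] at h1 h2
    exact ⟨by rw [← h1]; exact Finset.sum_subtype _ (by simp) _,
      by conv_rhs => rw [← h2]
         exact Finset.sum_subtype _ (by simp) _⟩
  have hst' : s ⊆ t.toFinset := fun i hi => by simpa using hst hi
  have hout : ∀ x, (∀ i ∈ t, i ∉ s → κ i x = 0) →
      ∑ i ∈ s, κ i x = 1 ∧ ∑ i ∈ s, κ i x • i = x := by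
    intro x hx
    obtain ⟨h1, h2⟩ := hsum x
    constructor
    · conv_rhs => rw [← h1]
      exact Finset.sum_subset hst' fun i hi his => hx i (by simpa using hi) his
    · conv_rhs => rw [← h2]
      exact Finset.sum_subset hst' fun i hi his => by
        rw [hx i (by simpa using hi) his, zero_smul]
  have hmem : ∀ x, x ∈ convexHull ℝ (s : Set E) ↔
      (∀ i ∈ s, 0 ≤ κ i x) ∧ ∀ i ∈ t, i ∉ s → κ i x = 0 := by
    intro x
    constructor
    · intro hx
      obtain ⟨w, hw0, hw1, rfl⟩ := Finset.mem_convexHull'.1 hx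
      refine ⟨fun i hi => ?_, fun i hi his => ?_⟩
      · rw [hcomb w hw1 i (hst hi), if_pos hi]; exact hw0 i hi
      · rw [hcomb w hw1 i hi, if_neg his]
    · rintro ⟨h0, h1⟩
      exact Finset.mem_convexHull'.2 ⟨fun i => κ i x, h0, (hout x h1).1, (hout x h1).2⟩
  -- All coordinates must be nonnegative, and those outside `s` also nonpositive.
  refine ⟨⟨(fun i => -κ i) '' t ∪ κ '' (t \ s), ?_, ?_⟩, κ, fun i hi => ⟨?_, fun j hj hij => ?_⟩⟩
  · exact (t.toFinite.image _).union ((t.toFinite.subset sdiff_subset).image _)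
  · ext x
    rw [hmem]
    constructor
    · rintro ⟨h0, h1⟩ ℓ (⟨i, hi, rfl⟩ | ⟨i, hi, rfl⟩)
      · by_cases his : i ∈ s
        · simpa using h0 i his
        · simp [h1 i hi his]
      · exact (h1 i hi.1 (by simpa using hi.2)).le
    · intro h
      have h0 : ∀ i ∈ t, 0 ≤ κ i x := fun i hi => by
        simpa using h _ (Or.inl ⟨i, hi, rfl⟩)
      exact ⟨fun i hi => h0 i (hst hi), fun i hi his =>
        le_antisymm (h _ (Or.inr ⟨i, ⟨hi, by simpa using his⟩, rfl⟩)) (h0 i hi)⟩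
  · rw [hκδ i (hst hi) i (hst hi), if_pos rfl]
  · rw [hκδ i (hst hi) j (hst hj), if_neg hij]

/-- `f` agrees near `y` in `X` with finitely many affine maps, each on a convex polyhedron. -/
def PolyAffineAt (f : E → F) (X : Set E) (y : E) : Prop :=
  ∃ C : Set (Set E × (E →ᵃ[ℝ] F)), C.Finite ∧ (∀ c ∈ C, IsPolyhedron c.1) ∧
    (∀ᶠ x in 𝓝[X] y, ∃ c ∈ C, x ∈ c.1) ∧
    ∀ c ∈ C, ∀ᶠ x in 𝓝[X] y, x ∈ c.1 → f x = c.2 x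

/-- The pieces of the composite are those of `f` cut by the affine preimages of those of `g`; they
remain finitely many convex polyhedra. -/
lemma PolyAffineAt.comp {f : E → F} {g : F → H} {X : Set E} {Y : Set F} {y : E} {z : F}
    (hg : PolyAffineAt g Y z) (hf : PolyAffineAt f X y) (ht : Tendsto f (𝓝[X] y) (𝓝[Y] z)) :
    PolyAffineAt (g ∘ f) X y := by
  obtain ⟨C, hC, hCp, hCc, hCa⟩ := hf
  obtain ⟨D, hD, hDp, hDc, hDa⟩ := hg
  refine ⟨(fun q : (Set E × (E →ᵃ[ℝ] F)) × (Set F × (F →ᵃ[ℝ] H)) =>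
    (q.1.1 ∩ q.1.2 ⁻¹' q.2.1, q.2.2.comp q.1.2)) '' (C ×ˢ D), (hC.prod hD).image _, ?_, ?_, ?_⟩
  · rintro _ ⟨⟨c, d⟩, ⟨hc, hd⟩, rfl⟩
    exact (hCp c hc).inter ((hDp d hd).preimage _)
  · filter_upwards [hCc, ht.eventually hDc, (hC.eventually_all).2 hCa]
      with x ⟨c, hc, hxc⟩ ⟨d, hd, hxd⟩ h3
    refine ⟨_, ⟨(c, d), ⟨hc, hd⟩, rfl⟩, hxc, ?_⟩
    rw [mem_preimage, ← h3 c hc hxc]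
    exact hxd
  · rintro _ ⟨⟨c, d⟩, ⟨hc, hd⟩, rfl⟩
    filter_upwards [hCa c hc, ht.eventually (hDa d hd)] with x h1 h2 hx
    have h3 := h1 hx.1
    have h4 : f x ∈ d.1 := by rw [h3]; exact hx.2
    exact (h2 h4).trans (congrArg d.2 h3)

lemma PolyAffineAt.congr_nhdsWithin {f : E → F} {X Y : Set E} {y : E} (hf : PolyAffineAt f X y)
    (h : 𝓝[Y] y = 𝓝[X] y) : PolyAffineAt f Y y := by
  unfold PolyAffineAt at *
  rwa [h]

/-- A piecewise affine map is affine, near `y`, on every set on which finitely many nonzero affine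
functionals have constant sign. -/
lemma PolyAffineAt.exists_functionals {f : E → F} {X : Set E} {y : E} (hf : PolyAffineAt f X y) :
    ∃ Λ : Set (E →ᵃ[ℝ] ℝ), Λ.Finite ∧ (∀ ℓ ∈ Λ, ℓ ≠ 0) ∧ ∃ U ∈ 𝓝[X] y, ∀ R ⊆ U,
      (∀ ℓ ∈ Λ, (∀ x ∈ R, ℓ x < 0) ∨ ∀ x ∈ R, 0 < ℓ x) → ∃ A : E →ᵃ[ℝ] F, ∀ x ∈ R, f x = A x := by
  obtain ⟨C, hC, hCp, hCc, hCa⟩ := hf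
  choose! Λ hΛ hΛe using hCp
  -- The zero functional imposes no condition and can be dropped. A set of constant strict signs
  -- that meets a piece lies in it, so the affine map of that piece serves throughout.
  refine ⟨{ℓ ∈ ⋃ c ∈ C, Λ c | ℓ ≠ 0}, (hC.biUnion hΛ).subset (sep_subset _ _), fun ℓ h => h.2,
    _, inter_mem hCc ((hC.eventually_all).2 hCa), fun R hR hsign => ?_⟩
  rcases R.eq_empty_or_nonempty with rfl | ⟨x, hx⟩
  · exact ⟨0, by simp⟩
  obtain ⟨c, hc, hxc⟩ := (hR hx).1
  refine ⟨c.2, fun x' hx' => (hR hx').2 c hc ?_⟩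
  rw [hΛe c hc] at hxc ⊢
  intro ℓ hℓ
  by_cases h0 : ℓ = 0
  · simp [h0]
  rcases hsign ℓ ⟨mem_biUnion hc hℓ, h0⟩ with h | h
  · exact (h x' hx').le
  · exact absurd (hxc ℓ hℓ) (not_le.2 (h x hx))

open Classical in
/-- The extension by zero of a map between subsets of vector spaces. -/
noncomputable def extend {X : Set E} {Y : Set F} (f : X → Y) (x : E) : F :=
  if h : x ∈ X then f ⟨x, h⟩ else 0

lemma extend_of_mem {X : Set E} {Y : Set F} (f : X → Y) {x : E} (h : x ∈ X) :
    extend f x = f ⟨x, h⟩ := dif_pos h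

lemma extend_coe {X : Set E} {Y : Set F} (f : X → Y) (x : X) : extend f x = f x :=
  extend_of_mem f x.2

lemma extend_mem {X : Set E} {Y : Set F} (f : X → Y) {x : E} (h : x ∈ X) : extend f x ∈ Y := by
  rw [extend_of_mem f h]; exact Subtype.coe_prop _

lemma continuousOn_extend {X : Set E} {Y : Set F} {f : X → Y} (hf : Continuous f) :
    ContinuousOn (extend f) X := by
  rw [continuousOn_iff_continuous_domRestrict]
  exact (continuous_subtype_val.comp hf).congr fun x => (extend_coe f x).symm

lemma tendsto_extend {X : Set E} {Y : Set F} {f : X → Y} (hf : Continuous f) {x : E} (h : x ∈ X) :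
    Tendsto (extend f) (𝓝[X] x) (𝓝[Y] (extend f x)) :=
  tendsto_nhdsWithin_iff.2 ⟨continuousOn_extend hf x h,
    eventually_mem_nhdsWithin.mono fun _ => extend_mem f⟩

lemma extend_symm_extend {X : Set E} {Y : Set F} (φ : X ≃ₜ Y) {x : E} (hx : x ∈ X) :
    extend φ.symm (extend φ x) = x := by
  rw [extend_of_mem φ hx, extend_coe, φ.symm_apply_apply]

lemma extend_extend_symm {X : Set E} {Y : Set F} (φ : X ≃ₜ Y) {y : F} (hy : y ∈ Y) :
    extend φ (extend φ.symm y) = y := extend_symm_extend φ.symm hy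

/-- Local finiteness leaves finitely many simplices near x, and each simplex is a convex polyhedron.
-/
lemma IsPL.polyAffineAt [FiniteDimensional ℝ E] {X : Set E} {Y : Set F} {f : X → Y} (hf : IsPL f)
    {x : E} (hx : x ∈ X) : PolyAffineAt (extend f) X x := by
  obtain ⟨T, hT⟩ := hf
  choose! A hA using hT
  obtain ⟨U, hU, hfin⟩ := T.locallyFinite x hx
  refine ⟨(fun s : Finset E => (convexHull ℝ (s : Set E), A s)) '' _, hfin.image _, ?_, ?_, ?_⟩
  · rintro _ ⟨s, hs, rfl⟩
    exact (exists_simplex_coords (T.complex.indep hs.1)).1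
  · filter_upwards [self_mem_nhdsWithin, mem_nhdsWithin_of_mem_nhds hU] with z hz hzU
    rw [← T.space_eq, Geometry.SimplicialComplex.mem_space_iff] at hz
    obtain ⟨s, hs, hzs⟩ := hz
    exact ⟨_, ⟨s, ⟨hs, z, hzs, hzU⟩, rfl⟩, hzs⟩
  · rintro _ ⟨s, hs, rfl⟩
    filter_upwards [self_mem_nhdsWithin] with z hz hzs
    rw [extend_of_mem f hz]
    exact hA s hs.1 ⟨z, hz⟩ hzs

/-- An affine map injective on a simplex maps its vertices to affinely independent points. -/
lemma affineIndependent_image [DecidableEq F] {s : Finset E}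
    (hs : AffineIndependent ℝ ((↑) : s → E))
    (A : E →ᵃ[ℝ] F) (hA : InjOn A (convexHull ℝ (s : Set E))) :
    AffineIndependent ℝ ((↑) : s.image A → F) := by
  suffices h : AffineIndependent ℝ (fun i : s => A i) by
    refine h.range.mono (s := (s.image A : Set F)) ?_
    rintro _ hx
    obtain ⟨i, hi, rfl⟩ := Finset.mem_image.1 (Finset.mem_coe.1 hx)
    exact ⟨⟨i, hi⟩, rfl⟩
  rw [affineIndependent_iff] at hs ⊢
  intro r w hw0 hw e he
  refine hs r w hw0 ?_ e he
  have hcard : (0 : ℝ) < r.card := by exact_mod_cast Finset.card_pos.2 ⟨e, he⟩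
  have hcard' : (r.card : ℝ) * (r.card : ℝ)⁻¹ = 1 := mul_inv_cancel₀ hcard.ne'
  -- A dependence w among the images would let the barycentre move along w without changing its
  -- image. As K bounds every |w i|, a step of size ε keeps the weights nonnegative, so injectivity
  -- on the simplex applies.
  set K : ℝ := 1 + ∑ i ∈ r, |w i| with hK
  have hKpos : 0 < K := add_pos_of_pos_of_nonneg one_pos (Finset.sum_nonneg fun i _ => abs_nonneg _)
  set ε : ℝ := (r.card : ℝ)⁻¹ * K⁻¹ with hε
  have hεpos : 0 < ε := by positivity
  have hsum : ∀ δ : ℝ, ∑ i ∈ r, ((r.card : ℝ)⁻¹ + δ * w i) = 1 := by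
    intro δ
    rw [Finset.sum_add_distrib, ← Finset.mul_sum, hw0, Finset.sum_const, nsmul_eq_mul, hcard']
    ring
  have hnn : ∀ δ : ℝ, 0 ≤ δ → δ ≤ ε → ∀ i ∈ r, 0 ≤ (r.card : ℝ)⁻¹ + δ * w i := by
    intro δ hδ0 hδ i hi
    have h1 : |w i| ≤ K := by
      have := Finset.single_le_sum (f := fun i => |w i|) (fun i _ => abs_nonneg _) hi
      rw [hK]; linarith
    have h2 : δ * |w i| ≤ (r.card : ℝ)⁻¹ := by
      calc δ * |w i| ≤ ε * K := mul_le_mul hδ h1 (abs_nonneg _) hεpos.le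
        _ = (r.card : ℝ)⁻¹ := by rw [hε, mul_assoc, inv_mul_cancel₀ hKpos.ne', mul_one]
    have h3 : -(δ * |w i|) ≤ δ * w i := by
      rw [← mul_neg]; exact mul_le_mul_of_nonneg_left (neg_abs_le _) hδ0
    linarith
  have hmem : ∀ δ : ℝ, 0 ≤ δ → δ ≤ ε →
      ∑ i ∈ r, ((r.card : ℝ)⁻¹ + δ * w i) • (i : E) ∈ convexHull ℝ (s : Set E) :=
    fun δ h0 h1 => (convex_convexHull ℝ _).sum_mem (hnn δ h0 h1) (hsum δ)
      fun i _ => subset_convexHull ℝ _ i.2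
  have himg : ∀ δ : ℝ, A (∑ i ∈ r, ((r.card : ℝ)⁻¹ + δ * w i) • (i : E)) =
      ∑ i ∈ r, (r.card : ℝ)⁻¹ • A i := by
    intro δ
    rw [affine_map_sum _ _ _ _ (hsum δ)]
    simp only [add_smul, mul_smul, Finset.sum_add_distrib, ← Finset.smul_sum, hw, smul_zero,
      add_zero]
  have := hA (hmem ε hεpos.le le_rfl) (hmem 0 le_rfl hεpos.le) ((himg ε).trans (himg 0).symm)
  simp only [add_smul, mul_smul, Finset.sum_add_distrib, ← Finset.smul_sum, zero_smul,
    add_zero, add_eq_left] at this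
  exact (smul_eq_zero.1 this).resolve_left hεpos.ne'

/-- An affine map injective on a simplex has an affine inverse on the image. -/
lemma exists_affine_inverse [FiniteDimensional ℝ F] [DecidableEq F] {s : Finset E}
    (hs : AffineIndependent ℝ ((↑) : s → E))
    (A : E →ᵃ[ℝ] F) (hA : InjOn A (convexHull ℝ (s : Set E))) :
    ∃ B : F →ᵃ[ℝ] E, ∀ x ∈ convexHull ℝ (s : Set E), B (A x) = x := by
  classical
  obtain ⟨-, κ, hκ⟩ := exists_simplex_coords (affineIndependent_image hs A hA)
  -- `B` sends each vertex A i of the image simplex back to i.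
  let B : F →ᵃ[ℝ] E := ∑ i ∈ s, (LinearMap.toSpanSingleton ℝ E i).toAffineMap.comp (κ (A i))
  have hB : ∀ x, B x = ∑ i ∈ s, κ (A i) x • i := by
    intro x
    have : ∀ t : Finset E, (∑ i ∈ t, (LinearMap.toSpanSingleton ℝ E i).toAffineMap.comp
        (κ (A i)) : F →ᵃ[ℝ] E) x = ∑ i ∈ t, κ (A i) x • i := by
      intro t
      induction t using Finset.induction_on with
      | empty => simp
      | insert a t ha ih => 
        rw [Finset.sum_insert ha, Finset.sum_insert ha, AffineMap.coe_add, Pi.add_apply, ih]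
        rfl
    exact this s
  refine ⟨B, fun x hx => ?_⟩
  obtain ⟨w, hw0, hw1, rfl⟩ := Finset.mem_convexHull'.1 hx
  rw [affine_map_sum _ _ _ _ hw1, affine_map_sum _ _ _ _ hw1]
  refine Finset.sum_congr rfl fun j hj => ?_
  have hsub := subset_convexHull ℝ (s : Set E)
  rw [hB, Finset.sum_eq_single j, (hκ _ (Finset.mem_image_of_mem A hj)).1, one_smul]
  · intro i hi hij
    rw [(hκ _ (Finset.mem_image_of_mem A hi)).2 _ (Finset.mem_image_of_mem A hj)
      (fun h => hij (hA (hsub hi) (hsub hj) h)), zero_smul]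
  · exact fun h => absurd hj h

/-- The inverse of a piecewise linear homeomorphism is piecewise affine. -/
lemma IsPL.polyAffineAt_symm [FiniteDimensional ℝ F] {X : Set E} {Y : Set F}
    {φ : X ≃ₜ Y} (hφ : IsPL φ) {y : F} (hy : y ∈ Y) : PolyAffineAt (extend φ.symm) Y y := by
  classical
  obtain ⟨T, hT⟩ := hφ
  choose! A hA using hT
  have hsub : ∀ s ∈ T.complex.faces, convexHull ℝ (s : Set E) ⊆ X := fun s hs => by
    rw [← T.space_eq]; exact Geometry.SimplicialComplex.convexHull_subset_space hs
  have hinj : ∀ s ∈ T.complex.faces, InjOn (A s) (convexHull ℝ (s : Set E)) := by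
    intro s hs x hx x' hx' h
    rw [← hA s hs ⟨x, hsub s hs hx⟩ hx, ← hA s hs ⟨x', hsub s hs hx'⟩ hx'] at h
    exact congrArg Subtype.val (φ.injective (Subtype.ext h))
  choose! B hB using fun s (hs : s ∈ T.complex.faces) =>
    exists_affine_inverse (T.complex.indep hs) (A s) (hinj s hs)
  -- Finiteness is taken at the preimage of y and carried to y by continuity of `φ.symm`.
  obtain ⟨U, hU, hfin⟩ := T.locallyFinite (extend φ.symm y) (extend_mem _ hy)
  have himg : ∀ s, convexHull ℝ ((s.image (A s) : Finset F) : Set F) =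
      A s '' convexHull ℝ (s : Set E) := fun s => by
    rw [AffineMap.image_convexHull, Finset.coe_image]
  refine ⟨(fun s : Finset E => (convexHull ℝ ((s.image (A s) : Finset F) : Set F), B s)) '' _,
    hfin.image _, ?_, ?_, ?_⟩
  · rintro _ ⟨s, hs, rfl⟩
    exact (exists_simplex_coords
      (affineIndependent_image (T.complex.indep hs.1) (A s) (hinj s hs.1))).1
  · filter_upwards [self_mem_nhdsWithin,
      (tendsto_extend φ.symm.continuous hy).eventually (mem_nhdsWithin_of_mem_nhds hU)]
      with z hz hzU
    have hzX := extend_mem φ.symm hz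
    obtain ⟨s, hs, hzs⟩ := Geometry.SimplicialComplex.mem_space_iff.1 (T.space_eq.ge hzX)
    refine ⟨_, ⟨s, ⟨hs, _, hzs, hzU⟩, rfl⟩, ?_⟩
    refine (himg s).ge ⟨_, hzs, ?_⟩
    rw [← hA s hs ⟨_, hzX⟩ hzs, ← extend_of_mem φ hzX, extend_extend_symm φ hz]
  · rintro _ ⟨s, hs, rfl⟩
    filter_upwards [self_mem_nhdsWithin] with z hz hzs
    simp only [himg] at hzs
    obtain ⟨x, hx, rfl⟩ := hzs
    have hxX := hsub s hs.1 hx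
    rw [hB s hs.1 x hx, ← hA s hs.1 ⟨x, hxX⟩ hx, ← extend_of_mem φ hxX, extend_symm_extend φ hxX]

end PiecewiseAffine

/-! ### Triviality near the global fixed point. -/

section BasePoint

variable {E : Type*} [NormedAddCommGroup E] [NormedSpace ℝ E]

lemma lineMap_eq_add (p x : E) (t : ℝ) : AffineMap.lineMap p x t = p + t • (x - p) := by
  simp [AffineMap.lineMap_apply, add_comm]

lemma add_smul_mem_segment {p x : E} {t d : ℝ} (ht : 0 ≤ t) (htd : t ≤ d) :
    p + t • (x - p) ∈ segment ℝ p (AffineMap.lineMap p x d) := by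
  rcases ht.eq_or_lt with rfl | ht0
  · simpa using left_mem_segment ℝ p _
  have hd : 0 < d := ht0.trans_le htd
  rw [segment_eq_image_lineMap]
  refine ⟨t / d, ⟨by positivity, (div_le_one hd).2 htd⟩, ?_⟩
  rw [lineMap_eq_add, lineMap_eq_add, add_sub_cancel_left, smul_smul, div_mul_cancel₀ _ hd.ne']

/-- A PL homeomorphism that fixes `p` and preserves the germ of a ray at `p` scales this ray. -/
lemma exists_ray_scale {M : Set E} (f : M ≃ₜ M) (hf : IsPL f) {p : M} (hp : f p = p) {x : E}
    (hx : x ≠ p) (hM : segment ℝ (p : E) x ⊆ M)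
    (hray : ray (p : E) x =ᶠ[𝓝 (p : E)] imageSet f (ray (p : E) x)) :
    ∃ a : ℝ, 0 < a ∧ ∀ᶠ t in 𝓝[>] (0 : ℝ),
      extend f (p + t • (x - p)) = p + (a * t) • (x - p) := by
  obtain ⟨T, hT⟩ := hf
  obtain ⟨s, hs, d, hd0, hd1, hps, hds⟩ := T.exists_simplex hM
  obtain ⟨A, hA⟩ := hT s hs
  have hAp : A p = p := by rw [← hA p hps, hp]
  have hxM : ∀ t : ℝ, 0 ≤ t → t ≤ 1 → (p : E) + t • (x - p) ∈ M := fun t h0 h1 => hM (by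
    simpa using add_smul_mem_segment (p := (p : E)) (x := x) h0 h1)
  have hlin : ∀ t : ℝ, 0 ≤ t → t ≤ d →
      extend f (p + t • (x - p)) = p + t • A.linear (x - p) := by
    intro t h0 h1
    rw [extend_of_mem f (hxM t h0 (h1.trans hd1)), hA _
      ((convex_convexHull ℝ _).segment_subset hps hds (add_smul_mem_segment h0 h1)),
      affine_apply_add, hAp, map_smul]
  have hlt : ∀ᶠ t in 𝓝[>] (0 : ℝ), t < d := mem_nhdsWithin_of_mem_nhds (gt_mem_nhds hd0)
  -- One small t suffices: the image is again on the ray, with parameter τ, and linearity makes τ /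
  -- t the scale factor for all small parameters.
  obtain ⟨t, ⟨h1, h2⟩, h0⟩ := (((tendsto_add_smul (p : E) (A.linear (x - p))).eventually
    (eventuallyEq_set.1 hray)).and hlt |>.and self_mem_nhdsWithin).exists
  have h0' : 0 < t := h0
  obtain ⟨τ, hτ, hτe⟩ := h1.2 ⟨⟨_, hxM t h0'.le (h2.le.trans hd1)⟩,
    ⟨t, ⟨h0'.le, h2.trans_le hd1⟩, lineMap_eq_add _ _ _⟩, by
      rw [← extend_of_mem, hlin t h0'.le h2.le]⟩
  rw [lineMap_eq_add, add_right_inj] at hτe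
  have hτ0 : τ ≠ 0 := by
    rintro rfl
    have h3 := hlin t h0'.le h2.le
    rw [← hτe, zero_smul, add_zero, extend_of_mem f (hxM t h0'.le (h2.le.trans hd1))] at h3
    have h4 := congrArg Subtype.val (f.injective ((Subtype.ext h3).trans hp.symm))
    simp only [add_eq_left] at h4
    rcases smul_eq_zero.1 h4 with h | h
    · exact h0'.ne' h
    · exact hx (sub_eq_zero.1 h)
  refine ⟨τ / t, div_pos (hτ.1.lt_of_ne' hτ0) h0', ?_⟩
  have hAv : A.linear (x - p) = (τ / t) • (x - (p : E)) := by
    rw [div_eq_inv_mul, mul_smul, hτe, inv_smul_smul₀ h0'.ne']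
  filter_upwards [hlt, self_mem_nhdsWithin] with t' ht' ht0'
  rw [hlin t' (le_of_lt ht0') ht'.le, hAv, smul_smul, mul_comm]

variable {G : Type*} [Group G] {M : Set E} (ρ : G →* (M ≃ₜ M)) (hρ : ∀ g, IsPL (ρ g)) {p : M}
  (hp : ∀ g, ρ g p = p)

lemma extend_mul (g k : G) {z : E} (hz : z ∈ M) :
    extend (ρ (g * k)) z = extend (ρ g) (extend (ρ k) z) := by
  rw [extend_of_mem _ hz, extend_of_mem _ hz, extend_coe, map_mul, Homeomorph.mul_apply]

lemma extend_one {z : E} (hz : z ∈ M) : extend (ρ 1) z = z := by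
  rw [extend_of_mem _ hz, map_one, Homeomorph.one_apply]

/-- Classes in the tangent sphere come from segments ending in the link. A segment inside a simplex
has the germ of such a ray, so the trivial action applies to it. -/
lemma ray_germ_invariant (htriv : ∀ (g : G) (r : TangentSphere M (p : E)),
      tangentAction ρ hρ hp g r = r) (T : Triangulation M) {s : Finset E}
    (hs : s ∈ T.complex.faces) (hps : (p : E) ∈ convexHull ℝ (s : Set E)) {x : E}
    (hxs : x ∈ convexHull ℝ (s : Set E)) (hx : x ≠ p) (g : G) :
    ray (p : E) x =ᶠ[𝓝 (p : E)] imageSet (ρ g) (ray (p : E) x) := by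
  obtain ⟨c, hc, hl⟩ := T.exists_link hx hs hps hxs
  have hg := ray_germ hc hx rfl
  let r : T.rays (p : E) := ⟨_, _, hl, rfl⟩
  have h := (tangentMap_mk (ρ g) (hρ g) (hp g) T T r r).1 (htriv g (.mk T r))
  exact hg.symm.trans (h.trans (imageSet_germ (ρ g) (hp g) hg))

/-- A group without real characters that acts trivially on the tangent sphere at `p` fixes the
initial pieces of the segments at `p`. -/
lemma eventually_fixed_ray (hG : ∀ f : G → ℝ, (∀ g k, f (g * k) = f g + f k) → ∀ g, f g = 0)
    {x : E} (hx : x ≠ p) (hM : segment ℝ (p : E) x ⊆ M)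
    (hray : ∀ g, ray (p : E) x =ᶠ[𝓝 (p : E)] imageSet (ρ g) (ray (p : E) x))
    (hρ : ∀ g, IsPL (ρ g)) (hp : ∀ g, ρ g p = p) (g : G) :
    ∀ᶠ t in 𝓝[>] (0 : ℝ), extend (ρ g) (p + t • (x - p)) = p + t • (x - p) := by
  choose a ha0 ha using fun g => exists_ray_scale (ρ g) (hρ g) (hp g) hx hM (hray g)
  have hmul : ∀ g k, a (g * k) = a g * a k := by
    intro g k
    have ht : Tendsto (fun t : ℝ => a k * t) (𝓝[>] 0) (𝓝[>] 0) := by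
      refine tendsto_nhdsWithin_iff.2 ⟨?_, ?_⟩
      · have : Continuous fun t : ℝ => a k * t := by fun_prop
        simpa using (this.tendsto 0).mono_left (nhdsWithin_le_nhds (s := Ioi 0))
      · filter_upwards [self_mem_nhdsWithin] with t ht
        exact mul_pos (ha0 k) ht
    have hlt : ∀ᶠ t in 𝓝[>] (0 : ℝ), t < 1 := mem_nhdsWithin_of_mem_nhds (gt_mem_nhds one_pos)
    obtain ⟨t, ⟨e1, e2, e3, e4⟩, ht0⟩ := (((ha (g * k)).and ((ha k).and
      ((ht.eventually (ha g)).and hlt))).and self_mem_nhdsWithin).exists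
    have ht0' : 0 < t := ht0
    have hmem : (p : E) + t • (x - p) ∈ M := hM (by
      simpa using add_smul_mem_segment (p := (p : E)) (x := x) ht0'.le e4.le)
    rw [extend_mul ρ g k hmem, e2, e3, add_right_inj] at e1
    have := smul_left_injective ℝ (sub_ne_zero.2 hx) e1
    exact mul_right_cancel₀ ht0'.ne' (by rw [mul_assoc]; exact this.symm)
  have h1 := mul_character_eq_one hG a ha0 hmul g
  simpa [h1] using ha g

/-- How long a piece of a ray is fixed may depend on the ray. This does no harm: near p every z
shares with p a simplex on which g is affine, and fixing p and one further point of the segment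
towards z forces z to be fixed. -/
theorem eventually_fixed_base
    (hG : ∀ f : G → ℝ, (∀ g k, f (g * k) = f g + f k) → ∀ g, f g = 0)
    (htriv : ∀ (g : G) (r : TangentSphere M (p : E)), tangentAction ρ hρ hp g r = r) (g : G) :
    ∀ᶠ z in 𝓝[M] (p : E), extend (ρ g) z = z := by
  obtain ⟨T, hT⟩ := hρ g
  obtain ⟨U, hU, hfin⟩ := T.locallyFinite p p.2
  have hstar : ∀ᶠ z in 𝓝[M] (p : E), ∃ s ∈ T.complex.faces,
      (p : E) ∈ convexHull ℝ (s : Set E) ∧ z ∈ convexHull ℝ (s : Set E) := by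
    have hfar : ∀ᶠ z in 𝓝 (p : E), ∀ s ∈ {s ∈ T.complex.faces |
        (convexHull ℝ (s : Set E) ∩ U).Nonempty}, (p : E) ∉ convexHull ℝ (s : Set E) →
        z ∉ convexHull ℝ (s : Set E) := by
      refine (hfin.eventually_all).2 fun s _ => ?_
      by_cases hps : (p : E) ∈ convexHull ℝ (s : Set E)
      · exact Eventually.of_forall fun z h => absurd hps h
      · filter_upwards [(s.finite_toSet.isClosed_convexHull ℝ).isOpen_compl.mem_nhds hps]
          with z hz _ using hz
    filter_upwards [self_mem_nhdsWithin, mem_nhdsWithin_of_mem_nhds hU,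
      mem_nhdsWithin_of_mem_nhds hfar] with z hz hzU hzf
    obtain ⟨s, hs, hzs⟩ := Geometry.SimplicialComplex.mem_space_iff.1 (T.space_eq.ge hz)
    refine ⟨s, hs, ?_, hzs⟩
    by_contra hps
    exact hzf s ⟨hs, z, hzs, hzU⟩ hps hzs
  filter_upwards [hstar, self_mem_nhdsWithin] with z ⟨s, hs, hps, hzs⟩ hzM
  by_cases hzp : z = p
  · rw [hzp, extend_coe, hp]
  have hseg := (convex_convexHull ℝ (s : Set E)).segment_subset hps hzs
  have hsM : convexHull ℝ (s : Set E) ⊆ M := by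
    rw [← T.space_eq]; exact Geometry.SimplicialComplex.convexHull_subset_space hs
  have hev := eventually_fixed_ray ρ hG hzp (hseg.trans hsM)
    (ray_germ_invariant ρ hρ hp htriv T hs hps hzs hzp) hρ hp g
  have hlt : ∀ᶠ t in 𝓝[>] (0 : ℝ), t < 1 := mem_nhdsWithin_of_mem_nhds (gt_mem_nhds one_pos)
  obtain ⟨t, ⟨e1, e2⟩, ht0⟩ := ((hev.and hlt).and self_mem_nhdsWithin).exists
  have ht0' : 0 < t := ht0
  obtain ⟨A, hA⟩ := hT s hs
  have hAp : A p = p := by rw [← hA p hps, hp]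
  have hmem : (p : E) + t • (z - p) ∈ convexHull ℝ (s : Set E) := hseg (by
    simpa using add_smul_mem_segment (p := (p : E)) (x := z) ht0'.le e2.le)
  rw [extend_of_mem _ (hsM hmem), hA _ hmem, affine_apply_add, hAp, map_smul, add_right_inj] at e1
  have e3 := smul_right_injective E ht0'.ne' e1
  rw [extend_of_mem _ hzM, hA ⟨z, hzM⟩ hzs]
  have e4 := affine_apply_add A p (z - p)
  rwa [hAp, e3, add_sub_cancel] at e4

end BasePoint

/-! ### Propagation across walls in a convex open set. -/

section Propagation

variable {V W : Type*} [NormedAddCommGroup V] [NormedSpace ℝ V]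
  [NormedAddCommGroup W] [NormedSpace ℝ W]

/-- Being moved is an open condition; used contrapositively, a limit of fixed points is fixed. -/
lemma eventually_apply_ne {X : Type*} [TopologicalSpace X] [T2Space X] {f : X → X} {l : Filter X}
    {a b : X} (hf : Tendsto f l (𝓝 a)) (hl : l ≤ 𝓝 b) (hab : a ≠ b) : ∀ᶠ x in l, f x ≠ x :=
  (hf.prodMk_nhds hl).eventually (isClosed_diagonal.isOpen_compl.mem_nhds hab)

lemma affine_eq_of_eventually {A B : V →ᵃ[ℝ] W} {x : V} (h : ∀ᶠ z in 𝓝 x, A z = B z) : A = B := by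
  obtain ⟨U, hU, hUo, hxU⟩ := eventually_nhds_iff.1 h
  exact AffineMap.ext_on (hUo.affineSpan_eq_top ⟨x, hxU⟩) hU

variable [FiniteDimensional ℝ V]

/-- Finitely many proper affine hyperplanes do not cover a nonempty open set. -/
lemma exists_forall_functional_ne_zero {Λ : Set (V →ᵃ[ℝ] ℝ)} (hΛ : Λ.Finite)
    (h0 : ∀ ℓ ∈ Λ, ℓ ≠ 0) {U : Set V} (hU : IsOpen U) (hne : U.Nonempty) :
    ∃ x ∈ U, ∀ ℓ ∈ Λ, ℓ x ≠ 0 := by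
  induction Λ, hΛ using Set.Finite.induction_on generalizing U with
  | empty => exact hne.imp fun x hx => ⟨hx, by simp⟩
  | @insert ℓ Λ _ _ ih =>
    have hne' : (U ∩ {x | ℓ x ≠ 0}).Nonempty := by
      by_contra! he
      obtain ⟨x, hx⟩ := hne
      refine h0 ℓ (mem_insert _ _) (affine_eq_of_eventually (x := x) ?_)
      filter_upwards [hU.mem_nhds hx] with z hz
      by_contra hzn
      exact eq_empty_iff_forall_notMem.1 he z ⟨hz, hzn⟩
    obtain ⟨x, hx, hxΛ⟩ := ih (fun k hk => h0 k (mem_insert_of_mem _ hk))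
      (hU.inter (isOpen_ne_fun ℓ.continuous_of_finiteDimensional continuous_const)) hne'
    exact ⟨x, hx.1, fun k hk => hk.elim (fun h => h ▸ hx.2) (hxΛ k)⟩

/-- An affine formula valid on an open half of a ball extends by continuity to the closed half. -/
lemma affine_on_closed_side {f : V → V} {c : V} {ε : ℝ} (hf : ContinuousOn f (Metric.ball c ε))
    {ℓ : V →ᵃ[ℝ] ℝ} (hc : ℓ c = 0) (hℓ : ℓ ≠ 0) {A : V →ᵃ[ℝ] V}
    (hA : ∀ x ∈ Metric.ball c ε, 0 < ℓ x → f x = A x) :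
    ∀ x ∈ Metric.ball c ε, 0 ≤ ℓ x → f x = A x := by
  intro x hx hx0
  rcases hx0.lt_or_eq with h | h
  · exact hA x hx h
  obtain ⟨v, hv⟩ := exists_affine_direction hc hℓ
  have hlim := tendsto_add_smul x v
  have hball := Metric.isOpen_ball.mem_nhds hx
  have h1 := ((hf.continuousAt hball).tendsto.comp hlim)
  have h2 := ((A.continuous_of_finiteDimensional.tendsto x).comp hlim)
  refine tendsto_nhds_unique (h1.congr' ?_) h2
  filter_upwards [hlim.eventually hball, self_mem_nhdsWithin] with t ht ht0
  refine hA _ ht ?_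
  rw [affine_apply_add, ← h, map_smul, hv]
  simpa using ht0

/-- A group without real characters, acting by piecewise affine germs on an open convex set, with
a common finite system of hyperplanes for a finite generating set, acts trivially if it does so near
one point. -/
theorem fixed_of_fixed_near {G : Type*} [Group G]
    (hG : ∀ f : G → ℝ, (∀ g k, f (g * k) = f g + f k) → ∀ g, f g = 0)
    {S : Set G} (hSfin : S.Finite) (hS : Submonoid.closure S = ⊤)
    {O : Set V} (hO : IsOpen O) (hOc : Convex ℝ O) (h : G → V → V)
    (hcont : ∀ s ∈ S, ContinuousOn (h s) O)
    (ht : ∀ c ∈ O, (∀ s ∈ S, h s c = c) → ∀ g, Tendsto (h g) (𝓝 c) (𝓝 c))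
    (h1 : ∀ c ∈ O, ∀ᶠ x in 𝓝 c, h 1 x = x)
    (hm : ∀ c ∈ O, (∀ s ∈ S, h s c = c) → ∀ g k, ∀ᶠ x in 𝓝 c, h (g * k) x = h g (h k x))
    {Λ : Set (V →ᵃ[ℝ] ℝ)} (hΛ : Λ.Finite) (hΛ0 : ∀ ℓ ∈ Λ, ℓ ≠ 0)
    (hR : ∀ R ⊆ O, (∀ ℓ ∈ Λ, (∀ x ∈ R, ℓ x < 0) ∨ ∀ x ∈ R, 0 < ℓ x) →
      ∀ s ∈ S, ∃ A : V →ᵃ[ℝ] V, ∀ x ∈ R, h s x = A x)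
    {a₀ : V} (ha₀ : a₀ ∈ O) (hfix : ∀ᶠ x in 𝓝 a₀, ∀ s ∈ S, h s x = x) :
    ∀ x ∈ O, ∀ s ∈ S, h s x = x := by
  set good : Set V := {x | ∀ᶠ z in 𝓝 x, ∀ s ∈ S, h s z = z} with hgood
  have hgo : IsOpen good := isOpen_iff_mem_nhds.2 fun x hx => eventually_eventually_nhds.2 hx
  obtain ⟨a, ⟨haO, hag⟩, ha⟩ :=
    exists_forall_functional_ne_zero hΛ hΛ0 (hO.inter hgo) ⟨a₀, ha₀, hfix⟩
  -- normalise the functionals at `a`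
  set Λ' : Set (V →ᵃ[ℝ] ℝ) := (fun ℓ => (ℓ a)⁻¹ • ℓ) '' Λ with hΛ'
  have hΛ'fin : Λ'.Finite := hΛ.image _
  have hΛ'a : ∀ ℓ ∈ Λ', ℓ a = 1 := by
    rintro _ ⟨ℓ, hℓ, rfl⟩
    exact inv_mul_cancel₀ (ha ℓ hℓ)
  have hR' : ∀ R ⊆ O, (∀ ℓ ∈ Λ', (∀ x ∈ R, ℓ x < 0) ∨ ∀ x ∈ R, 0 < ℓ x) →
      ∀ s ∈ S, ∃ A : V →ᵃ[ℝ] V, ∀ x ∈ R, h s x = A x := by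
    intro R hRO hsign
    refine hR R hRO fun ℓ hℓ => ?_
    have hval : ∀ x, ℓ x = ℓ a * ((ℓ a)⁻¹ • ℓ) x := fun x =>
      (mul_inv_cancel_left₀ (ha ℓ hℓ) (ℓ x)).symm
    rcases hsign _ (mem_image_of_mem _ hℓ) with hs | hs <;>
      rcases (ha ℓ hℓ).lt_or_gt with hl | hl
    · exact Or.inr fun x hx => by rw [hval]; exact mul_pos_of_neg_of_neg hl (hs x hx)
    · exact Or.inl fun x hx => by rw [hval]; exact mul_neg_of_pos_of_neg hl (hs x hx)
    · exact Or.inl fun x hx => by rw [hval]; exact mul_neg_of_neg_of_pos hl (hs x hx)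
    · exact Or.inr fun x hx => by rw [hval]; exact mul_pos hl (hs x hx)
  by_contra! hcon
  obtain ⟨x₀, hx₀, s₀, hs₀, hne₀⟩ := hcon
  have hnear : ∀ᶠ x in 𝓝 x₀, x ∈ O ∧ h s₀ x ≠ x :=
    (hO.eventually_mem hx₀).and
      (eventually_apply_ne ((hcont s₀ hs₀).continuousAt (hO.mem_nhds hx₀)) le_rfl hne₀)
  obtain ⟨U, hU, hUo, hxU⟩ := eventually_nhds_iff.1 hnear
  -- The endpoint b is a moved point at which distinct normalised functionals take distinct values.
  obtain ⟨b, hbU, hb⟩ := exists_forall_functional_ne_zero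
    (Λ := {k ∈ (fun q : (V →ᵃ[ℝ] ℝ) × (V →ᵃ[ℝ] ℝ) => q.1 - q.2) '' (Λ' ×ˢ Λ') | k ≠ 0})
    (((hΛ'fin.prod hΛ'fin).image _).subset (sep_subset _ _)) (fun k hk => hk.2) hUo ⟨x₀, hxU⟩
  have hbO := (hU b hbU).1
  have hsegO : segment ℝ a b ⊆ O := hOc.segment_subset haO hbO
  suffices hsub : segment ℝ a b ⊆ good by
    exact (hU b hbU).2 ((hsub (right_mem_segment ℝ a b)).self_of_nhds s₀ hs₀)
  refine (convex_segment a b).isPreconnected.subset_of_closure_inter_subset hgo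
    ⟨a, left_mem_segment ℝ a b, hag⟩ ?_
  rintro c ⟨hcg, hcs⟩
  have hcO := hsegO hcs
  have hfreq : ∃ᶠ x in 𝓝 c, x ∈ good := mem_closure_iff_frequently.1 hcg
  have hcfix : ∀ s ∈ S, h s c = c := by
    intro s hs
    by_contra hne
    refine hfreq ?_
    filter_upwards [eventually_apply_ne ((hcont s hs).continuousAt (hO.mem_nhds hcO)) le_rfl hne]
      with x hx hxg
    exact hx (hxg.self_of_nhds s hs)
  -- Both functionals equal 1 at a. A common zero on the segment would force equal values at b,
  -- which the choice of b excludes.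
  have huniq : ∀ ℓ ∈ Λ', ∀ k ∈ Λ', ℓ c = 0 → k c = 0 → ℓ = k := by
    intro ℓ hℓ k hk hℓc hkc
    by_contra hne
    refine hb (ℓ - k) ⟨⟨(ℓ, k), ⟨hℓ, hk⟩, rfl⟩, sub_ne_zero.2 hne⟩ ?_
    rw [segment_eq_image_lineMap] at hcs
    obtain ⟨t, ht, rfl⟩ := hcs
    rw [AffineMap.apply_lineMap, hΛ'a ℓ hℓ, lineMap_eq_add, smul_eq_mul] at hℓc
    rw [AffineMap.apply_lineMap, hΛ'a k hk, lineMap_eq_add, smul_eq_mul] at hkc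
    have ht0 : t ≠ 0 := by
      rintro rfl
      simp at hℓc
    have : t * (ℓ b - k b) = 0 := by linarith
    exact (mul_eq_zero.1 this).resolve_left ht0
  have hsigns : ∀ᶠ x in 𝓝 c, x ∈ O ∧ ∀ ℓ ∈ Λ', ℓ c ≠ 0 → 0 < ℓ c * ℓ x := by
    refine (hO.eventually_mem hcO).and ((hΛ'fin.eventually_all).2 fun ℓ _ => ?_)
    by_cases hℓc : ℓ c = 0
    · exact Eventually.of_forall fun x hx => absurd hℓc hx
    · have hcts : Continuous fun x => ℓ c * ℓ x :=
        continuous_const.mul ℓ.continuous_of_finiteDimensional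
      filter_upwards [(hcts.tendsto c).eventually (lt_mem_nhds (mul_self_pos.2 hℓc))] with x hx _
        using hx
  obtain ⟨ε, hε, hball⟩ := Metric.eventually_nhds_iff_ball.1 hsigns
  have hBO : Metric.ball c ε ⊆ O := fun x hx => (hball x hx).1
  have hBn : Metric.ball c ε ∈ 𝓝 c := Metric.ball_mem_nhds c hε
  have hsignB : ∀ ℓ ∈ Λ', ℓ c ≠ 0 →
      (∀ x ∈ Metric.ball c ε, ℓ x < 0) ∨ ∀ x ∈ Metric.ball c ε, 0 < ℓ x := by
    intro ℓ hℓ hℓc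
    rcases hℓc.lt_or_gt with hl | hl
    · exact Or.inl fun x hx => neg_of_mul_pos_right ((hball x hx).2 ℓ hℓ hℓc) hl.le
    · exact Or.inr fun x hx => pos_of_mul_pos_right ((hball x hx).2 ℓ hℓ hℓc) hl.le
  have hgB : (good ∩ Metric.ball c ε).Nonempty := (hfreq.and_eventually hBn).exists
  by_cases hex : ∃ ℓ ∈ Λ', ℓ c = 0
  · obtain ⟨ℓ₀, hℓ₀, hℓ₀c⟩ := hex
    have hℓ₀ne : ℓ₀ ≠ 0 := by
      rintro rfl
      simpa using hΛ'a 0 hℓ₀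
    have hside : ∀ ℓ : V →ᵃ[ℝ] ℝ, (ℓ = ℓ₀ ∨ ℓ = -ℓ₀) → ∀ s ∈ S, ∃ A : V →ᵃ[ℝ] V,
        ∀ x ∈ Metric.ball c ε, 0 ≤ ℓ x → h s x = A x := by
      intro ℓ hℓ s hs
      have hℓc : ℓ c = 0 := by rcases hℓ with rfl | rfl <;> simp [hℓ₀c]
      have hℓne : ℓ ≠ 0 := by rcases hℓ with rfl | rfl <;> simpa using hℓ₀ne
      obtain ⟨A, hA⟩ := hR' (Metric.ball c ε ∩ {x | 0 < ℓ x}) (inter_subset_left.trans hBO) (by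
        intro k hk
        by_cases hkc : k c = 0
        · obtain rfl := huniq ℓ₀ hℓ₀ k hk hℓ₀c hkc
          rcases hℓ with rfl | rfl
          · exact Or.inr fun x hx => hx.2
          · exact Or.inl fun x hx => by simpa using hx.2
        · exact (hsignB k hk hkc).imp (fun H x hx => H x hx.1) fun H x hx => H x hx.1) s hs
      exact ⟨A, affine_on_closed_side ((hcont s hs).mono hBO) hℓc hℓne
        fun x hx hx0 => hA x ⟨hx, hx0⟩⟩
    -- A good point off the wall shows on which side the generators are already the identity; ℓ is
    -- oriented to be negative there.
    obtain ⟨x₁, ⟨hx₁g, hx₁B⟩, hx₁⟩ := exists_forall_functional_ne_zero (Set.finite_singleton ℓ₀)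
      (by simpa using hℓ₀ne) (hgo.inter Metric.isOpen_ball) hgB
    have hx₁' : ℓ₀ x₁ ≠ 0 := hx₁ ℓ₀ rfl
    obtain ⟨ℓ, hℓ, hℓneg⟩ : ∃ ℓ : V →ᵃ[ℝ] ℝ, (ℓ = ℓ₀ ∨ ℓ = -ℓ₀) ∧ ℓ x₁ < 0 := by
      rcases hx₁'.lt_or_gt with hl | hl
      · exact ⟨ℓ₀, Or.inl rfl, hl⟩
      · exact ⟨-ℓ₀, Or.inr rfl, by simpa using hl⟩
    have hℓc : ℓ c = 0 := by rcases hℓ with rfl | rfl <;> simp [hℓ₀c]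
    have hℓne : ℓ ≠ 0 := by rcases hℓ with rfl | rfl <;> simpa using hℓ₀ne
    have hℓ' : -ℓ = ℓ₀ ∨ -ℓ = -ℓ₀ := by rcases hℓ with rfl | rfl <;> simp
    refine (hSfin.eventually_all).2 fun s _ => germ_action_trivial hG h (ht c hcO hcfix)
      (h1 c hcO) (hm c hcO hcfix) hℓc hℓne hS (fun s hs => ?_) (fun s hs => ?_) s
    · obtain ⟨A, hA⟩ := hside (-ℓ) hℓ' s hs
      have hAid : A = AffineMap.id ℝ V := by
        refine affine_eq_of_eventually (x := x₁) ?_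
        have hlt := (ℓ.continuous_of_finiteDimensional.tendsto x₁).eventually (gt_mem_nhds hℓneg)
        filter_upwards [hx₁g, Metric.isOpen_ball.mem_nhds hx₁B, hlt] with x e1 e2 e3
        rw [← hA x e2 (by simpa using e3.le), e1 s hs]
        rfl
      filter_upwards [hBn] with x hx hx0
      rw [hA x hx (by simpa using hx0), hAid]
      rfl
    · obtain ⟨A, hA⟩ := hside ℓ hℓ s hs
      exact ⟨A, by filter_upwards [hBn] with x hx using hA x hx⟩
  · push Not at hex
    refine (hSfin.eventually_all).2 fun s hs => ?_
    obtain ⟨A, hA⟩ := hR' _ hBO (fun ℓ hℓ => hsignB ℓ hℓ (hex ℓ hℓ)) s hs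
    obtain ⟨x₁, hx₁g, hx₁B⟩ := hgB
    have hAid : A = AffineMap.id ℝ V := by
      refine affine_eq_of_eventually (x := x₁) ?_
      filter_upwards [hx₁g, Metric.isOpen_ball.mem_nhds hx₁B] with x e1 e2
      rw [← hA x e2, e1 s hs]
      rfl
    filter_upwards [hBn] with x hx
    rw [hA x hx, hAid]
    rfl

end Propagation

/-! ### The open cube and its closure. -/

section Cube

variable {n : ℕ}

/-- The open cube `(0,1)ⁿ`. -/
def openCube (n : ℕ) : Set (EuclideanSpace ℝ (Fin n)) :=
  {y | ∀ i, y i ∈ Ioo (0 : ℝ) 1}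

lemma isOpen_openCube : IsOpen (openCube n) := by
  have : openCube n = ⋂ i, (fun y : EuclideanSpace ℝ (Fin n) => y i) ⁻¹' Ioo (0 : ℝ) 1 := by
    ext y; simp [openCube]
  rw [this]
  exact isOpen_iInter_of_finite fun i => isOpen_Ioo.preimage (by fun_prop)

lemma convex_openCube : Convex ℝ (openCube n) := by
  intro x hx y hy a b ha hb hab i
  exact convex_Ioo (0 : ℝ) 1 (hx i) (hy i) ha hb hab

lemma openCube_subset_cube : openCube n ⊆ cube n := fun _ hx i => Ioo_subset_Icc_self (hx i)

lemma cube_subset_closure_openCube : cube n ⊆ closure (openCube n) := by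
  intro x hx
  let m : EuclideanSpace ℝ (Fin n) := WithLp.toLp 2 fun _ => 1 / 2
  -- Any move towards the centre m enters the open cube.
  refine mem_closure_of_tendsto (tendsto_add_smul x (m - x)) ?_
  have hlt : ∀ᶠ t in 𝓝[>] (0 : ℝ), t < 1 := mem_nhdsWithin_of_mem_nhds (gt_mem_nhds one_pos)
  filter_upwards [self_mem_nhdsWithin, hlt] with t ht ht1 i
  have ht0 : 0 < t := ht
  have hi := hx i
  have hval : (x + t • (m - x)) i = x i + t * (1 / 2 - x i) := by simp [m]
  rw [hval]
  constructor
  · nlinarith [mul_nonneg (sub_nonneg.2 ht1.le) hi.1]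
  · nlinarith [mul_nonneg (sub_nonneg.2 ht1.le) (sub_nonneg.2 hi.2)]

end Cube

/-! ### Passing to limit points through a chart. -/

section Chart

variable {E : Type*} [NormedAddCommGroup E] [NormedSpace ℝ E] [FiniteDimensional ℝ E]
  {G : Type*} [Group G] {M : Set E}

/-- In a PL manifold, a limit of points near which the group acts trivially is such a point. -/
theorem eventually_fixed_of_frequently {n : ℕ} (hM : IsPLManifold n M) (ρ : G →* (M ≃ₜ M))
    (hρ : ∀ g, IsPL (ρ g))
    (hG : ∀ f : G → ℝ, (∀ g k, f (g * k) = f g + f k) → ∀ g, f g = 0)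
    {S : Set G} (hSfin : S.Finite) (hS : Submonoid.closure S = ⊤) {q : E} (hq : q ∈ M)
    (hfreq : ∃ᶠ z in 𝓝[M] q, ∀ᶠ z' in 𝓝[M] z, ∀ s ∈ S, extend (ρ s) z' = z') :
    ∀ᶠ z in 𝓝[M] q, ∀ s ∈ S, extend (ρ s) z = z := by
  obtain ⟨N, hNM, hN, φ, hφ⟩ := hM q hq
  have hqN : q ∈ N := mem_of_mem_nhdsWithin hq hN
  have hnhds : ∀ z ∈ N, N ∈ 𝓝[M] z → 𝓝[N] z = 𝓝[M] z := fun z _ hz =>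
    le_antisymm (nhdsWithin_mono z hNM) (nhdsWithin_le_of_mem hz)
  have hkt : ∀ g, ∀ z ∈ M, Tendsto (extend (ρ g)) (𝓝[M] z) (𝓝[M] (extend (ρ g) z)) :=
    fun g z hz => tendsto_extend (ρ g).continuous hz
  have hall : ∀ z ∈ M, (∀ s ∈ S, extend (ρ s) z = z) → ∀ g, extend (ρ g) z = z := by
    intro z hz hs g
    induction g using Submonoid.dense_induction S hS with
    | mem s h => exact hs s h
    | one => exact extend_one ρ hz
    | mul g k hg hk => rw [extend_mul ρ g k hz, hk, hg]
  have hqfix : ∀ s ∈ S, extend (ρ s) q = q := by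
    intro s hs
    by_contra hne
    refine hfreq ?_
    filter_upwards [eventually_apply_ne ((hkt s q hq).mono_right nhdsWithin_le_nhds)
      nhdsWithin_le_nhds hne, self_mem_nhdsWithin] with z hz hzM hzf
    exact hz (hzf.self_of_nhdsWithin hzM s hs)
  set Φ := extend φ with hΦ
  set ψ := extend φ.symm with hψ
  set y := Φ q with hy
  have hyQ : y ∈ cube n := extend_mem φ hqN
  have hψt : ∀ x ∈ cube n, Tendsto ψ (𝓝[cube n] x) (𝓝[M] (ψ x)) := fun x hx =>
    (tendsto_extend φ.symm.continuous hx).mono_right (nhdsWithin_mono _ hNM)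
  have hψt' : ∀ z ∈ N, Tendsto ψ (𝓝[cube n] (Φ z)) (𝓝[M] z) := by
    intro z hz
    have h1 := hψt (Φ z) (extend_mem φ hz)
    rwa [hψ, hΦ, extend_symm_extend φ hz] at h1
  have hψN : ∀ x ∈ cube n, ψ x ∈ N := fun x hx => extend_mem φ.symm hx
  have hΦψ : ∀ x ∈ cube n, Φ (ψ x) = x := fun x hx => extend_extend_symm φ hx
  have hΦt : ∀ z ∈ N, N ∈ 𝓝[M] z → Tendsto Φ (𝓝[M] z) (𝓝[cube n] (Φ z)) := by
    intro z hz hzn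
    rw [← hnhds z hz hzn]
    exact tendsto_extend φ.continuous hz
  -- This is the action read in the chart. It is meaningful only where the image stays in `N`, as
  -- `Φ` is 0 elsewhere; hence the composition law is claimed only near fixed points.
  let h : G → EuclideanSpace ℝ (Fin n) → EuclideanSpace ℝ (Fin n) :=
    fun g x => Φ (extend (ρ g) (ψ x))
  have hpoly : ∀ s ∈ S, PolyAffineAt (h s) (cube n) y := by
    intro s hs
    have h1 : PolyAffineAt ψ (cube n) y := hφ.polyAffineAt_symm hyQ
    have h2 : PolyAffineAt (extend (ρ s)) M q := (hρ s).polyAffineAt hq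
    have h3 : PolyAffineAt Φ M q := (hφ.polyAffineAt hqN).congr_nhdsWithin (hnhds q hqN hN).symm
    have h4 := h2.comp h1 (hψt' q hqN)
    refine h3.comp h4 ((?_ : Tendsto (extend (ρ s)) (𝓝[M] q) (𝓝[M] q)).comp (hψt' q hqN))
    have := hkt s q hq
    rwa [hqfix s hs] at this
  choose! Λ hΛfin hΛ0 U hU hΛ using fun s hs => (hpoly s hs).exists_functionals
  have hNev : ∀ᶠ z in 𝓝[M] q, N ∈ 𝓝[M] z := eventually_eventually_nhdsWithin.2 hN
  have hnice : ∀ᶠ x in 𝓝[cube n] y, N ∈ 𝓝[M] (ψ x) ∧ ∀ s ∈ S, x ∈ U s ∧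
      N ∈ 𝓝[M] (extend (ρ s) (ψ x)) ∧ extend (ρ s) (ψ x) ∈ N := by
    refine ((hψt' q hqN).eventually hNev).and ((hSfin.eventually_all).2 fun s hs => ?_)
    have hk := hkt s q hq
    rw [hqfix s hs] at hk
    exact (show ∀ᶠ x in 𝓝[cube n] y, x ∈ U s from hU s hs).and
      (((hk.comp (hψt' q hqN)).eventually hNev).and ((hk.comp (hψt' q hqN)).eventually hN))
  obtain ⟨r, hr, hrnice⟩ := Metric.mem_nhdsWithin_iff.1 hnice
  -- This set is open in the Euclidean space and convex even if y is a boundary point of the cube.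
  set O := openCube n ∩ Metric.ball y r with hOdef
  have hO : IsOpen O := isOpen_openCube.inter Metric.isOpen_ball
  have hOQ : O ⊆ cube n := fun x hx => openCube_subset_cube hx.1
  have hOn : ∀ x ∈ O, 𝓝[cube n] x = 𝓝 x := fun x hx =>
    nhdsWithin_eq_nhds.2 (mem_of_superset (hO.mem_nhds hx) hOQ)
  have hOnice := fun x (hx : x ∈ O) => hrnice ⟨hx.2, hOQ hx⟩
  have hψO : ∀ x ∈ O, Tendsto ψ (𝓝 x) (𝓝[M] (ψ x)) := fun x hx => hOn x hx ▸ hψt x (hOQ hx)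
  have hfixψ : ∀ x ∈ O, (∀ s ∈ S, h s x = x) → ∀ s ∈ S, extend (ρ s) (ψ x) = ψ x := by
    intro x hx hs s hsS
    -- The image must lie in `N`, so that `Φ` does not take its default value and `ψ` inverts it.
    have h1 : ψ (h s x) = extend (ρ s) (ψ x) :=
      extend_symm_extend φ ((hOnice x hx).2 s hsS).2.2
    rw [← h1, hs s hsS]
  have hclosed : ∀ x ∈ cube n ∩ Metric.ball y r, ∃ᶠ x' in 𝓝[cube n] x, x' ∈ O := by
    intro x hx
    rw [frequently_nhdsWithin_iff]
    exact ((mem_closure_iff_frequently.1 (cube_subset_closure_openCube hx.1)).and_eventually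
      (Metric.isOpen_ball.eventually_mem hx.2)).mono fun x' hx' => ⟨hx', hOQ hx'⟩
  have htO : ∀ c ∈ O, (∀ s ∈ S, h s c = c) → ∀ g,
      Tendsto (fun x => extend (ρ g) (ψ x)) (𝓝 c) (𝓝[M] (ψ c)) := by
    intro c hc hs g
    have h1 := hkt g (ψ c) (hNM (hψN c (hOQ hc)))
    rw [hall (ψ c) (hNM (hψN c (hOQ hc))) (hfixψ c hc hs) g] at h1
    exact h1.comp (hψO c hc)
  obtain ⟨a₀, ha₀, hfix⟩ : ∃ a₀ ∈ O, ∀ᶠ x in 𝓝 a₀, ∀ s ∈ S, extend (ρ s) (ψ x) = ψ x := by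
    have hball : ∀ᶠ z in 𝓝[M] q, Φ z ∈ Metric.ball y r :=
      ((hΦt q hqN hN).mono_right nhdsWithin_le_nhds).eventually (Metric.ball_mem_nhds y hr)
    obtain ⟨z, hz, hzN, hzb⟩ := (hfreq.and_eventually ((show ∀ᶠ z in 𝓝[M] q, z ∈ N from hN).and
      hball)).exists
    have hzQ : Φ z ∈ cube n := extend_mem φ hzN
    have h1 := (hψt' z hzN).eventually hz
    obtain ⟨x, hxO, hx⟩ := ((hclosed _ ⟨hzQ, hzb⟩).and_eventually
      (eventually_eventually_nhdsWithin.2 h1)).exists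
    exact ⟨x, hxO, by rwa [hOn x hxO] at hx⟩
  have hmain : ∀ x ∈ O, ∀ s ∈ S, h s x = x := by
    refine fixed_of_fixed_near hG hSfin hS hO (convex_openCube.inter (convex_ball y r)) h
      ?_ ?_ ?_ ?_ (Λ := ⋃ s ∈ S, Λ s) (hSfin.biUnion hΛfin) ?_ ?_ ha₀ ?_
    · intro s hs x hx
      have hx' := (hOnice x hx).2 s hs
      have h1 := ((hΦt _ hx'.2.2 hx'.2.1).comp
        ((hkt s _ (hNM (hψN x (hOQ hx)))).comp (hψO x hx))).mono_right nhdsWithin_le_nhds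
      exact h1.mono_left nhdsWithin_le_nhds
    · intro c hc hs g
      have h1 := ((hΦt _ (hψN c (hOQ hc)) (hOnice c hc).1).comp (htO c hc hs g)).mono_right
        nhdsWithin_le_nhds
      rwa [hΦψ c (hOQ hc)] at h1
    · intro c hc
      filter_upwards [hO.mem_nhds hc] with x hx
      change Φ (extend (ρ 1) (ψ x)) = x
      rw [extend_one ρ (hNM (hψN x (hOQ hx))), hΦψ x (hOQ hx)]
    · intro c hc hs g k
      filter_upwards [hO.mem_nhds hc, (htO c hc hs k).eventually (hOnice c hc).1] with x hx hxk
      change Φ (extend (ρ (g * k)) (ψ x)) = Φ (extend (ρ g) (ψ (Φ (extend (ρ k) (ψ x)))))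
      rw [extend_mul ρ g k (hNM (hψN x (hOQ hx))), hψ, hΦ, extend_symm_extend φ hxk]
    · intro ℓ hℓ
      obtain ⟨s, hs, hℓs⟩ := mem_iUnion₂.1 hℓ
      exact hΛ0 s hs ℓ hℓs
    · intro R hR hsign s hs
      exact hΛ s hs R (fun x hx => ((hOnice x (hR hx)).2 s hs).1)
        fun ℓ hℓ => hsign ℓ (mem_biUnion hs hℓ)
    · filter_upwards [hfix, hO.mem_nhds ha₀] with x hx hxO s hs
      change Φ (extend (ρ s) (ψ x)) = x
      rw [hx s hs, hΦψ x (hOQ hxO)]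
  have hball : ∀ᶠ z in 𝓝[M] q, Φ z ∈ Metric.ball y r :=
    ((hΦt q hqN hN).mono_right nhdsWithin_le_nhds).eventually (Metric.ball_mem_nhds y hr)
  filter_upwards [hN, hball] with z hzN hzb s hs
  have hzQ : Φ z ∈ cube n := extend_mem φ hzN
  -- A moved z would have only moved points nearby, but points of `O`, all fixed in the chart,
  -- accumulate at Φ z.
  by_contra hne
  refine hclosed _ ⟨hzQ, hzb⟩ ?_
  filter_upwards [(hψt' z hzN).eventually (eventually_apply_ne
    ((hkt s z (hNM hzN)).mono_right nhdsWithin_le_nhds) nhdsWithin_le_nhds hne)] with x hx hxO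
  exact hx (hfixψ x hxO (hmain x hxO) s hs)

end Chart

end PLStability

/-! ### Global triviality by connectedness. -/

theorem theorem1p2 {G : Type} [Group G] [Group.FG G] {N n : ℕ}
    (M : Set (EuclideanSpace ℝ (Fin N))) (hM : PLStability.IsPLManifold n M)
    (hconn : IsConnected M)
    (ρ : G →* (M ≃ₜ M)) (hρ : ∀ g, PLStability.IsPL (ρ g))
    (p : M) (hp : ∀ g, ρ g p = p)
    (htriv : ∀ (g : G) (r : PLStability.TangentSphere M (p : EuclideanSpace ℝ (Fin N))),
      PLStability.tangentAction ρ hρ hp g r = r)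
    (hH : CategoryTheory.Limits.IsZero (groupHomology (Rep.trivial ℝ G ℝ) 1)) :
    ∀ (g : G) (x : M), ρ g x = x := by
  have hG := fun f hf g => PLStability.character_eq_zero hH f hf g
  obtain ⟨S, hS⟩ := Monoid.fg_def.1 (Group.fg_iff_monoid_fg.1 ‹Group.FG G›)
  -- Asking for a neighbourhood makes the set open; finiteness of `S` provides one common to all
  -- generators.
  let fixed : Set M := {x | ∀ᶠ z in 𝓝[M] (x : EuclideanSpace ℝ (Fin N)),
    ∀ s ∈ (S : Set G), PLStability.extend (ρ s) z = z}
  have hmap : ∀ x : M, Filter.map Subtype.val (𝓝 x) = 𝓝[M] (x : EuclideanSpace ℝ (Fin N)) :=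
    fun x => map_nhds_subtype_val x
  have hopen : IsOpen fixed := by
    refine isOpen_iff_mem_nhds.2 fun x hx => ?_
    have h1 := eventually_eventually_nhdsWithin.2 hx
    rw [← hmap, eventually_map] at h1
    exact h1
  have hclosed : IsClosed fixed := by
    refine isClosed_of_closure_subset fun x hx => ?_
    refine PLStability.eventually_fixed_of_frequently hM ρ hρ hG S.finite_toSet hS x.2 ?_
    rw [← hmap, frequently_map]
    exact mem_closure_iff_frequently.1 hx
  have hpf : p ∈ fixed := (S.finite_toSet.eventually_all).2 fun s _ =>
    PLStability.eventually_fixed_base ρ hρ hp hG htriv s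
  have : PreconnectedSpace M := Subtype.preconnectedSpace hconn.isPreconnected
  have huniv : fixed = Set.univ := IsClopen.eq_univ ⟨hclosed, hopen⟩ ⟨p, hpf⟩
  intro g x
  induction g using Submonoid.dense_induction (S : Set G) hS with
  | mem s hs =>
    have hx : x ∈ fixed := huniv ▸ Set.mem_univ x
    have h1 := Filter.Eventually.self_of_nhdsWithin hx x.2 s hs
    rw [PLStability.extend_coe] at h1
    exact Subtype.ext h1
  | one => rw [map_one, Homeomorph.one_apply]
  | mul g k hg hk => rw [map_mul, Homeomorph.mul_apply, hk, hg]
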